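/- Let $\gamma\in\mathbb{R}$ and $1<p<\infty$. Let $u_0\in H^1(\mathbb{R})=H^1(\mathbb{R},\mathbb{C})$ satisfy $xu_0\in L^2(\mathbb{R})$, let $0<T\le+\infty$, and let $u\in C([0,T),H^1(\mathbb{R}))\cap C^1([0,T),H^{-1}(\mathbb{R}))$ be a solution (for instance the maximal one) of the Cauchy problem $$i\partial_t u=-\partial_x^2u-\gamma\delta u-|u|^{p-1}u,\qquad u(0)=u_0,$$ where the equation holds in $H^{-1}(\mathbb{R})$ for every $t\in[0,T)$ and $\delta$ is the Dirac distribution at the origin, $\langle\delta,v\rangle=v(0)$ for $v\in H^1(\mathbb{R})$. Then $xu(t)\in L^2(\mathbb{R})$ for every $t\in[0,T)$, the function $f:t\mapsto\|xu(t)\|_{2}^2$ is of class $C^2$ on $[0,T)$ (with one-sided derivatives at $t=0$), and for every $t\in[0,T)$ $$f'(t)=4\,\mathrm{Im}\int_{\mathbb{R}}\overline{u(t,x)}\,x\,\partial_xu(t,x)\,dx,\qquad f''(t)=8\,Q_\gamma(u(t)),$$ where the integral converges absolutely and, for $v\in H^1(\mathbb{R})$, $$Q_\gamma(v)=\|\partial_xv\|_2^2-\frac{\gamma}{2}|v(0)|^2-\frac{p-1}{2(p+1)}\|v\|_{p+1}^{p+1}.$$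 -/

import Mathlib

open MeasureTheory
open scoped ContDiff

noncomputable section

namespace DeltaNLS

/-- The complex Hilbert space `L²(ℝ) = L²(ℝ, ℂ)`. -/
abbrev L2 : Type := Lp ℂ 2 (volume : Measure ℝ)

/-- `g` is the weak derivative of `v` on `ℝ`. -/
def IsWeakDeriv (v g : ℝ → ℂ) : Prop :=
  ∀ φ : ℝ → ℝ, ContDiff ℝ ∞ φ → HasCompactSupport φ →
    ∫ x, deriv φ x • v x = -∫ x, φ x • g x

theorem integrable_smul_L2 (f : L2) (ψ : ℝ → ℝ) (hψ : Continuous ψ) (hc : HasCompactSupport ψ) :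
    Integrable (fun x => ψ x • f x) :=
  ((Lp.memLp f).locallyIntegrable (by norm_num)).integrable_smul_left_of_hasCompactSupport hψ hc

theorem integrable_deriv_smul_L2 (f : L2) (φ : ℝ → ℝ) (hφ : ContDiff ℝ ∞ φ)
    (hc : HasCompactSupport φ) : Integrable (fun x => deriv φ x • f x) :=
  integrable_smul_L2 f _ (hφ.continuous_deriv (by simp)) hc.deriv

/-- The subspace of `L² × L²` formed by the pairs `(v, v')` such that `v'` is the weak derivative
of `v`. -/
def H1Submodule : Submodule ℂ (WithLp 2 (L2 × L2)) where
  carrier := {w | IsWeakDeriv w.fst w.snd}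
  zero_mem' := by
    intro φ hφ hc
    have h1 : ∀ᵐ x, ((0 : L2) : ℝ → ℂ) x = 0 := Lp.coeFn_zero ℂ 2 volume
    have e1 : (∫ x, deriv φ x • ((0 : L2) : ℝ → ℂ) x) = 0 := by
      refine integral_eq_zero_of_ae ?_
      filter_upwards [h1] with x hx
      rw [hx, smul_zero]; rfl
    have e2 : (∫ x, φ x • ((0 : L2) : ℝ → ℂ) x) = 0 := by
      refine integral_eq_zero_of_ae ?_
      filter_upwards [h1] with x hx
      rw [hx, smul_zero]; rfl
    change (∫ x, deriv φ x • ((0 : L2) : ℝ → ℂ) x) = -∫ x, φ x • ((0 : L2) : ℝ → ℂ) x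
    rw [e1, e2, neg_zero]
  add_mem' := by
    intro a b ha hb φ hφ hc
    have key : ∀ (ψ : ℝ → ℝ) (f g : L2), Integrable (fun x => ψ x • f x) →
        Integrable (fun x => ψ x • g x) →
        ∫ x, ψ x • (f + g : L2) x = (∫ x, ψ x • f x) + ∫ x, ψ x • g x := by
      intro ψ f g hf hg
      rw [← integral_add hf hg]
      refine integral_congr_ae ?_
      filter_upwards [Lp.coeFn_add f g] with x hx
      rw [hx]
      simp
    change (∫ x, deriv φ x • (a.fst + b.fst : L2) x) = -∫ x, φ x • (a.snd + b.snd : L2) x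
    rw [key _ _ _ (integrable_deriv_smul_L2 _ φ hφ hc) (integrable_deriv_smul_L2 _ φ hφ hc),
      key _ _ _ (integrable_smul_L2 _ φ hφ.continuous hc) (integrable_smul_L2 _ φ hφ.continuous hc), ha φ hφ hc, hb φ hφ hc]
    ring
  smul_mem' := by
    intro c a ha φ hφ hc
    have key : ∀ (ψ : ℝ → ℝ) (f : L2), ∫ x, ψ x • (c • f : L2) x = c * ∫ x, ψ x • f x := by
      intro ψ f
      rw [← integral_const_mul]
      refine integral_congr_ae ?_
      filter_upwards [Lp.coeFn_smul c f] with x hx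
      simp [hx]
      ring
    change (∫ x, deriv φ x • (c • a.fst : L2) x) = -∫ x, φ x • (c • a.snd : L2) x
    rw [key, key, ha φ hφ hc]
    ring

/-- The Sobolev space `H¹(ℝ) = H¹(ℝ, ℂ)` with the norm `(‖v‖₂² + ‖v'‖₂²)^(1/2)`. -/
abbrev H1 : Type := H1Submodule

theorem isWeakDeriv_primitive_real (g : ℝ → ℝ) (hg : LocallyIntegrable g volume) (φ : ℝ → ℝ) (hφ : ContDiff ℝ ∞ φ)
    (hc : HasCompactSupport φ) :
    ∫ x, deriv φ x * (∫ t in (0 : ℝ)..x, g t) = -∫ x, φ x * g x := by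
  obtain ⟨R, hR, hsub⟩ : ∃ R : ℝ, 0 < R ∧ tsupport φ ⊆ Set.Ioo (-R) R := by
    obtain ⟨R, hR⟩ := hc.isBounded.subset_ball_lt 0 0
    refine ⟨R, hR.1, ?_⟩
    simpa [Real.ball_eq_Ioo] using hR.2
  have hφ0 : ∀ x, x ∉ Set.Ioo (-R) R → φ x = 0 := fun x hx =>
    image_eq_zero_of_notMem_tsupport fun h => hx (hsub h)
  have hdφ0 : ∀ x, x ∉ Set.Ioo (-R) R → deriv φ x = 0 := fun x hx =>
    image_eq_zero_of_notMem_tsupport fun h => hx (hsub (tsupport_deriv_subset h))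
  have hii : IntervalIntegrable g volume (-R) R :=
    intervalIntegrable_iff.mpr <|
      (hg.integrableOn_isCompact isCompact_uIcc).mono_set Set.uIoc_subset_uIcc
  have hG := hii.absolutelyContinuousOnInterval_intervalIntegral (c := 0)
    (Set.mem_uIcc.2 (Or.inl ⟨by linarith, hR.le⟩))
  have hφa : AbsolutelyContinuousOnInterval φ (-R) R :=
    ((hφ.of_le (by simp)).contDiffOn).absolutelyContinuousOnInterval
  have key := hG.integral_mul_deriv_eq_deriv_mul hφa
  rw [hφ0 R (by simp), hφ0 (-R) (by simp)] at key
  have conv : ∀ F : ℝ → ℝ, (∀ x, x ∉ Set.Ioo (-R) R → F x = 0) →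
      ∫ x in (-R)..R, F x = ∫ x, F x := fun F hF => by
    rw [intervalIntegral.integral_of_le (by linarith)]
    exact setIntegral_eq_integral_of_forall_compl_eq_zero fun x hx =>
      hF x fun h => hx (Set.Ioo_subset_Ioc_self h)
  rw [conv _ (fun x hx => by simp [hdφ0 x hx]), conv _ (fun x hx => by simp [hφ0 x hx])] at key
  have e : ∫ x, deriv (fun x => ∫ v in (0 : ℝ)..x, g v) x * φ x = ∫ x, φ x * g x := by
    refine integral_congr_ae ?_
    filter_upwards [_root_.LocallyIntegrable.ae_hasDerivAt_integral hg] with x hx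
    rw [(hx 0).deriv, mul_comm]
  rw [e] at key
  simp only [mul_zero, sub_zero, zero_sub] at key
  rw [← key]
  exact integral_congr_ae (Filter.Eventually.of_forall fun x => mul_comm _ _)

theorem isWeakDeriv_primitive (g : ℝ → ℂ) (hg : LocallyIntegrable g volume) :
    IsWeakDeriv (fun x => ∫ t in (0 : ℝ)..x, g t) g := by
  intro φ hφ hc
  have hii : ∀ a b, IntervalIntegrable g volume a b := fun a b =>
    intervalIntegrable_iff.mpr <|
      (hg.integrableOn_isCompact isCompact_uIcc).mono_set Set.uIoc_subset_uIcc
  have hcont := intervalIntegral.continuous_primitive hii 0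
  have hi1 : Integrable (fun x => deriv φ x • ∫ t in (0 : ℝ)..x, g t) :=
    ((hφ.continuous_deriv (by simp)).smul hcont).integrable_of_hasCompactSupport hc.deriv.smul_right
  have hi2 : Integrable (fun x => φ x • g x) :=
    hg.integrable_smul_left_of_hasCompactSupport hφ.continuous hc
  have part : ∀ L : ℂ →L[ℝ] ℝ, L (∫ x, deriv φ x • ∫ t in (0 : ℝ)..x, g t)
      = L (-∫ x, φ x • g x) := by
    intro L
    have hL : LocallyIntegrable (fun x => L (g x)) volume := fun x => by
      obtain ⟨s, hs, h⟩ := hg x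
      exact ⟨s, hs, L.integrable_comp h⟩
    have := isWeakDeriv_primitive_real _ hL φ hφ hc
    rw [map_neg, ← L.integral_comp_comm hi1, ← L.integral_comp_comm hi2]
    simp only [map_smul, smul_eq_mul]
    rw [← this]
    refine integral_congr_ae (Filter.Eventually.of_forall fun x => ?_)
    simp only
    rw [← L.intervalIntegral_comp_comm (hii 0 x)]
  exact Complex.ext (part Complex.reCLM) (part Complex.imCLM)

theorem ae_eq_const_of_isWeakDeriv_zero (h : ℝ → ℂ) (hl : LocallyIntegrable h volume)
    (h0 : IsWeakDeriv h 0) : ∃ c, h =ᵐ[volume] fun _ => c := by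
  let φ : ℕ → ContDiffBump (0 : ℝ) := fun n =>
    ⟨1 / (n + 1), 2 / (n + 1), by positivity, by gcongr; norm_num⟩
  have hconst : ∀ n x y, (convolution ((φ n).normed volume) h (ContinuousLinearMap.lsmul ℝ ℝ) volume) x
      = (convolution ((φ n).normed volume) h (ContinuousLinearMap.lsmul ℝ ℝ) volume) y := by
    intro n x y
    have hd : ∀ x, HasDerivAt
        (convolution ((φ n).normed volume) h (ContinuousLinearMap.lsmul ℝ ℝ) volume) 0 x := by
      intro x
      have := ((φ n).hasCompactSupport_normed (μ := volume)).hasDerivAt_convolution_left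
        (ContinuousLinearMap.lsmul ℝ ℝ) ((φ n).contDiff_normed (n := 1)) hl x
      suffices z : convolution (deriv ((φ n).normed volume)) h
          (ContinuousLinearMap.lsmul ℝ ℝ) volume x = 0 by rwa [z] at this
      rw [convolution_eq_swap]
      have hs : ContDiff ℝ ∞ (fun t => (φ n).normed volume (x - t)) :=
        (φ n).contDiff_normed.comp (contDiff_const.sub contDiff_id)
      have hcs : HasCompactSupport (fun t => (φ n).normed volume (x - t)) :=
        ((φ n).hasCompactSupport_normed (μ := volume)).comp_homeomorph (Homeomorph.subLeft x)
      have := h0 _ hs hcs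
      simp only [Pi.zero_apply, smul_zero, integral_zero, neg_zero] at this
      have e : ∀ t, deriv (fun t => (φ n).normed volume (x - t)) t
          = - deriv ((φ n).normed volume) (x - t) := fun t => deriv_comp_const_sub _ _ _
      simp only [e, neg_smul, integral_neg, neg_eq_zero] at this
      simpa using this
    exact is_const_of_deriv_eq_zero (fun x => (hd x).differentiableAt) (fun x => (hd x).deriv) x y
  have hT : Filter.Tendsto (fun n => (φ n).rOut) Filter.atTop (nhds 0) := by
    have := (tendsto_one_div_add_atTop_nhds_zero_nat (𝕜 := ℝ)).const_mul 2
    simpa [φ, div_eq_mul_inv] using this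
  have hae := ContDiffBump.ae_convolution_tendsto_right_of_locallyIntegrable (μ := volume)
    (φ := φ) (K := 2) hT (Filter.Eventually.of_forall fun n => by
      simp only [φ]; exact le_of_eq (by ring)) hl
  obtain ⟨x₀, hx₀⟩ := hae.exists
  refine ⟨h x₀, ?_⟩
  filter_upwards [hae] with x hx
  exact tendsto_nhds_unique hx (by simpa only [hconst _ x x₀] using hx₀)

theorem exists_continuous_ae_eq (v g : L2) (h : IsWeakDeriv v g) : ∃ w : ℝ → ℂ, Continuous w ∧ w =ᵐ[volume] v := by
  have hv : LocallyIntegrable v := (Lp.memLp v).locallyIntegrable (by norm_num)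
  have hg : LocallyIntegrable g := (Lp.memLp g).locallyIntegrable (by norm_num)
  have hG := isWeakDeriv_primitive g hg
  have hcont : Continuous (fun x => ∫ t in (0 : ℝ)..x, g t) :=
    intervalIntegral.continuous_primitive (fun a b => intervalIntegrable_iff.mpr <|
      (hg.integrableOn_isCompact isCompact_uIcc).mono_set Set.uIoc_subset_uIcc) 0
  obtain ⟨c, hc⟩ := ae_eq_const_of_isWeakDeriv_zero (fun x => v x - ∫ t in (0 : ℝ)..x, g t)
    (hv.sub hcont.locallyIntegrable) (by
      intro φ hφ hs
      have hdc := hφ.continuous_deriv (by simp)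
      simp only [smul_sub]
      rw [integral_sub (hv.integrable_smul_left_of_hasCompactSupport hdc hs.deriv)
        (hcont.locallyIntegrable.integrable_smul_left_of_hasCompactSupport hdc hs.deriv),
        h φ hφ hs, hG φ hφ hs]
      simp)
  refine ⟨fun x => (∫ t in (0 : ℝ)..x, g t) + c, by fun_prop, ?_⟩
  filter_upwards [hc] with x hx
  rw [← hx]; ring

/-- `H⁻¹(ℝ)`: the space of continuous linear functionals on `H¹(ℝ)`, with the dual norm. -/
abbrev Hneg1 : Type := StrongDual ℂ H1

namespace H1

/-- The continuous representative of `v ∈ H¹(ℝ)`. -/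
def rep (v : H1) : ℝ → ℂ := (exists_continuous_ae_eq v.1.fst v.1.snd v.2).choose

theorem continuous_rep (v : H1) : Continuous v.rep :=
  (exists_continuous_ae_eq v.1.fst v.1.snd v.2).choose_spec.1

theorem rep_ae_eq (v : H1) : v.rep =ᵐ[volume] v.1.fst :=
  (exists_continuous_ae_eq v.1.fst v.1.snd v.2).choose_spec.2

instance : CoeFun H1 (fun _ => ℝ → ℂ) := ⟨rep⟩

/-- The weak derivative `∂ₓ v ∈ L²(ℝ)` of `v ∈ H¹(ℝ)`. -/
def dx (v : H1) : L2 := v.1.snd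

/-- The embedding of `H¹(ℝ)` into `H⁻¹(ℝ)` through `⟨v, w⟩ = ∫ v w dx`. -/
def toHneg1 (v : H1) : Hneg1 :=
  (innerSL ℂ (star v.1.fst)).comp ((WithLp.fstL 2 ℂ L2 L2).comp H1Submodule.subtypeL)

theorem toHneg1_apply (v w : H1) : v.toHneg1 w = ∫ x, v x * w x := by
  change inner ℂ (star v.1.fst) w.1.fst = _
  rw [L2.inner_def]
  refine integral_congr_ae ?_
  filter_upwards [Lp.coeFn_star v.1.fst, v.rep_ae_eq, w.rep_ae_eq] with x h1 h2 h3
  rw [h1, h2, h3]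
  simp [mul_comm]

end H1

/-- The time interval `[0, T)`, where `T` may be `+∞`. -/
def timeInterval (T : EReal) : Set ℝ := {t | 0 ≤ t ∧ (t : EReal) < T}

/-- `u ∈ C([0,T), H¹(ℝ)) ∩ C¹([0,T), H⁻¹(ℝ))` solves, in `H⁻¹(ℝ)` and for every `t ∈ [0, T)`,
`i ∂ₜu = -∂ₓ²u - γ δ u - |u|^(p-1) u`, where `⟨δ, v⟩ = v(0)`, and `u(0) = u₀`. -/
structure IsSolution (γ p : ℝ) (u₀ : H1) (T : EReal) (u : ℝ → H1) : Prop where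
  continuousOn : ContinuousOn u (timeInterval T)
  contDiffOn : ContDiffOn ℝ 1 (fun t => (u t).toHneg1) (timeInterval T)
  eq : ∀ t ∈ timeInterval T, ∀ v : H1,
    Complex.I * derivWithin (fun s => (u s).toHneg1) (timeInterval T) t v =
      (∫ x, (u t).dx x * v.dx x) - (γ : ℂ) * (u t 0 * v 0)
        - ∫ x, ((‖u t x‖ ^ (p - 1) : ℝ) : ℂ) * u t x * v x
  initial : u 0 = u₀

/-- `Q_γ(v) = ‖∂ₓv‖₂² - (γ/2) |v(0)|² - (p-1)/(2(p+1)) ‖v‖_{p+1}^{p+1}`. -/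
def Q (γ p : ℝ) (v : H1) : ℝ :=
  ‖v.dx‖ ^ 2 - γ / 2 * ‖v 0‖ ^ 2 - (p - 1) / (2 * (p + 1)) * ∫ x, ‖v x‖ ^ (p + 1)

/-- `‖x v‖₂²`. -/
def variance (v : H1) : ℝ := ∫ x : ℝ, ‖(x : ℂ) * v x‖ ^ 2

end DeltaNLS

end

noncomputable section

namespace DeltaNLS

open Filter Topology

/-! Formally one tests the equation with `x²ū` and then with a multiple of `x∂ₓū`. Neither test
function need lie in `H¹`, so each is replaced by an admissible one, the identity is integrated in
time, and the limit is taken under the time integral.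

For the variance, `x²` becomes the bounded weight `θ = x²/(1+εx²)`. Testing with `θū` and taking the
imaginary part removes every real term, the Dirac one included, and leaves `d/dt ∫θ|u|² = 2 Im
∫θ'ū∂ₓu`. Since `θ'² ≤ 4θ`, Grönwall bounds `∫θ|u|²` uniformly in `ε`, and Fatou gives `xu(t) ∈ L²`.
Dominated convergence then yields `variance_eq_integral`.

For the momentum, `x∂ₓu` is the derivative at `c = 1` of the dilation `u(cx)`, which stays in `H¹`.
So `Im ∫ū x∂ₓu` is the derivative at `c = 1` of `Im ∫u(cx)ū(x)dx`, and the time derivative of this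
integral is `E(c) - c⁻¹E(c⁻¹)`, where `E` is `energyCorrelation`. Divided by `c - 1`, it has three
limits as `c ↓ 1`: the kinetic part is `(c - c⁻¹)` times a quantity merely continuous at `1`, so no
second derivative of `u` is needed; the Dirac part is explicit, because dilations fix the origin;
the potential part needs one derivative at `1`, which exists because `xu ∈ L²` and is computed by
touching with a majorant from Young's inequality. The sum is `2Q`. Bounds uniform in time and in `c`
near `1` give `weightedMomentum_eq_integral`.

Finally `Q` is continuous along the solution, so the fundamental theorem of calculus turns both
integral identities into derivatives. The underlying differentiation rule is
`hasDerivWithinAt_pairing`: `u` is only continuous into `H¹` and differentiable into `H⁻¹`. -/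

/-! ### `L²` estimates, and weak derivatives under conjugation, dilation and multiplication. -/

/-- The `L²` norm of a function on the line. -/
def l2 (f : ℝ → ℂ) : ℝ := (eLpNorm f 2 volume).toReal

theorem l2_nonneg (f : ℝ → ℂ) : 0 ≤ l2 f := ENNReal.toReal_nonneg

theorem l2_congr {f g : ℝ → ℂ} (h : f =ᵐ[volume] g) : l2 f = l2 g := by
  simp only [l2, eLpNorm_congr_ae h]

theorem l2_sq {f : ℝ → ℂ} (hf : MemLp f 2 volume) : l2 f ^ 2 = ∫ x, ‖f x‖ ^ 2 := by
  rw [l2, hf.eLpNorm_eq_integral_rpow_norm (by norm_num) (by norm_num)]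
  have h0 : 0 ≤ ∫ x, ‖f x‖ ^ (2 : ℝ) := integral_nonneg fun x => by positivity
  simp only [ENNReal.toReal_ofNat]
  rw [ENNReal.toReal_ofReal (by positivity), ← Real.rpow_natCast, ← Real.rpow_mul h0]
  simp

theorem integrable_mul_of_memLp {f g : ℝ → ℂ} (hf : MemLp f 2 volume) (hg : MemLp g 2 volume) :
    Integrable (fun x => f x * g x) :=
  hf.integrable_mul hg

theorem integral_norm_mul_le {f g : ℝ → ℂ} (hf : MemLp f 2 volume) (hg : MemLp g 2 volume) :
    ∫ x, ‖f x * g x‖ ≤ l2 f * l2 g := by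
  have h : eLpNorm (f • g) 1 volume ≤ eLpNorm f 2 volume * eLpNorm g 2 volume :=
    eLpNorm_smul_le_mul_eLpNorm hg.1 hf.1
  rw [l2, l2, ← ENNReal.toReal_mul]
  have h' := ENNReal.toReal_mono (ENNReal.mul_ne_top hf.2.ne hg.2.ne) h
  rw [eLpNorm_one_eq_lintegral_enorm] at h'
  refine le_trans (le_of_eq ?_) h'
  exact integral_norm_eq_lintegral_enorm (hf.1.mul hg.1)

theorem norm_integral_mul_le {f g : ℝ → ℂ} (hf : MemLp f 2 volume) (hg : MemLp g 2 volume) :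
    ‖∫ x, f x * g x‖ ≤ l2 f * l2 g :=
  (norm_integral_le_integral_norm _).trans (integral_norm_mul_le hf hg)

theorem l2_le_mul {f g : ℝ → ℂ} {C : ℝ} (hg : MemLp g 2 volume) (hC : 0 ≤ C)
    (h : ∀ᵐ x, ‖f x‖ ≤ C * ‖g x‖) : l2 f ≤ C * l2 g := by
  have := eLpNorm_le_mul_eLpNorm_of_ae_le_mul h 2
  have := ENNReal.toReal_mono (ENNReal.mul_ne_top ENNReal.ofReal_ne_top hg.2.ne) this
  rwa [ENNReal.toReal_mul, ENNReal.toReal_ofReal hC] at this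

theorem l2_add_le {f g : ℝ → ℂ} (hf : MemLp f 2 volume) (hg : MemLp g 2 volume) :
    l2 (fun x => f x + g x) ≤ l2 f + l2 g := by
  have := eLpNorm_add_le hf.1 hg.1 (p := 2) (by norm_num)
  have := ENNReal.toReal_mono (ENNReal.add_ne_top.2 ⟨hf.2.ne, hg.2.ne⟩) this
  rwa [ENNReal.toReal_add hf.2.ne hg.2.ne] at this

theorem quasiMeasurePreserving_mul_left {c : ℝ} (hc : c ≠ 0) :
    Measure.QuasiMeasurePreserving (fun x : ℝ => c * x) volume volume := by
  refine ⟨by fun_prop, ?_⟩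
  rw [Real.map_volume_mul_left hc]
  exact Measure.smul_absolutelyContinuous

theorem eLpNorm_dilation (f : ℝ → ℂ) {c : ℝ} (hc : 0 < c)
    (hf : AEStronglyMeasurable f volume) :
    eLpNorm (fun x => f (c * x)) 2 volume = ENNReal.ofReal (c⁻¹ ^ (1 / 2 : ℝ)) * eLpNorm f 2 volume := by
  have h1 := Real.map_volume_mul_left hc.ne'
  have h2 : AEStronglyMeasurable f (Measure.map (fun x => c * x) volume) := by
    rw [h1]; exact hf.smul_measure _
  have := eLpNorm_map_measure (p := 2) h2 (by fun_prop : AEMeasurable (fun x : ℝ => c * x) volume)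
  rw [h1, eLpNorm_smul_measure_of_ne_top (by norm_num), abs_of_pos (inv_pos.2 hc),
    ENNReal.ofReal_rpow_of_nonneg (inv_pos.2 hc).le (by norm_num)] at this
  simp only [Function.comp_def, smul_eq_mul] at this
  rw [← this]
  norm_num

theorem MemLp.dilation {f : ℝ → ℂ} (hf : MemLp f 2 volume) {c : ℝ} (hc : 0 < c) :
    MemLp (fun x => f (c * x)) 2 volume := by
  refine ⟨hf.1.comp_quasiMeasurePreserving (quasiMeasurePreserving_mul_left hc.ne'), ?_⟩
  rw [eLpNorm_dilation f hc hf.1]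
  exact ENNReal.mul_lt_top ENNReal.ofReal_lt_top hf.2

theorem l2_dilation {f : ℝ → ℂ} (hf : MemLp f 2 volume) {c : ℝ} (hc : 0 < c) :
    l2 (fun x => f (c * x)) = c⁻¹ ^ (1 / 2 : ℝ) * l2 f := by
  rw [l2, eLpNorm_dilation f hc hf.1, ENNReal.toReal_mul, ENNReal.toReal_ofReal (by positivity), l2]

theorem memLp_star {f : ℝ → ℂ} (hf : MemLp f 2 volume) :
    MemLp (fun x => (starRingEnd ℂ) (f x)) 2 volume := hf.star

theorem l2_star (f : ℝ → ℂ) : l2 (fun x => (starRingEnd ℂ) (f x)) = l2 f := by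
  rw [l2, l2]
  congr 1
  exact eLpNorm_congr_norm_ae (Eventually.of_forall fun x => by simp)

theorem memLp_bdd_mul {f : ℝ → ℂ} (hf : MemLp f 2 volume) {θ : ℝ → ℝ} (hθ : Continuous θ) {C : ℝ}
    (hC : ∀ x, |θ x| ≤ C) : MemLp (fun x => (θ x : ℂ) * f x) 2 volume := by
  refine hf.of_le_mul (c := C) ?_ (Eventually.of_forall fun x => ?_)
  · exact (Complex.continuous_ofReal.comp hθ).aestronglyMeasurable.mul hf.1
  · rw [norm_mul, Complex.norm_real]
    gcongr
    exact hC x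

theorem IsWeakDeriv.congr {v v' g g' : ℝ → ℂ} (h : IsWeakDeriv v g) (hv : v =ᵐ[volume] v')
    (hg : g =ᵐ[volume] g') : IsWeakDeriv v' g' := by
  intro φ hφ hc
  rw [integral_congr_ae (g := fun x => deriv φ x • v x), h φ hφ hc]
  · congr 1
    refine integral_congr_ae ?_
    filter_upwards [hg] with x hx
    rw [hx]
  · filter_upwards [hv] with x hx
    rw [hx]

theorem IsWeakDeriv.star {v g : ℝ → ℂ} (h : IsWeakDeriv v g) :
    IsWeakDeriv (fun x => (starRingEnd ℂ) (v x)) (fun x => (starRingEnd ℂ) (g x)) := by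
  intro φ hφ hc
  have := congrArg (starRingEnd ℂ) (h φ hφ hc)
  rw [map_neg, ← integral_conj, ← integral_conj] at this
  simpa using this

theorem IsWeakDeriv.dilation {v g : ℝ → ℂ} (h : IsWeakDeriv v g) {c : ℝ} (hc0 : 0 < c) :
    IsWeakDeriv (fun x => v (c * x)) (fun x => (c : ℂ) * g (c * x)) := by
  intro φ hφ hc
  have h1 := h (fun x => φ (c⁻¹ * x)) (by fun_prop)
    (hc.comp_homeomorph (Homeomorph.mulLeft₀ c⁻¹ (inv_ne_zero hc0.ne')))
  have hd : ∀ x, deriv (fun x => φ (c⁻¹ * x)) x = c⁻¹ * deriv φ (c⁻¹ * x) := fun x => by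
    rw [deriv_comp_mul_left]; simp
  simp only [hd] at h1
  have e1 := Measure.integral_comp_mul_left (fun y => deriv φ (c⁻¹ * y) • v y) c
  have e2 := Measure.integral_comp_mul_left (fun y => φ (c⁻¹ * y) • g y) c
  simp only [inv_mul_cancel_left₀ hc0.ne', abs_of_pos (inv_pos.2 hc0)] at e1 e2
  have e3 : ∀ x, φ x • ((c : ℂ) * g (c * x)) = (c : ℂ) * (φ x • g (c * x)) := fun x => by
    simp only [Complex.real_smul]; ring
  simp only [e3]
  rw [integral_const_mul, e1, e2]
  have h2 : ∀ x, (c⁻¹ * deriv φ (c⁻¹ * x)) • v x = (c⁻¹ : ℂ) * (deriv φ (c⁻¹ * x) • v x) := fun x => by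
    simp only [Complex.real_smul]; push_cast; ring
  simp only [h2] at h1
  rw [integral_const_mul] at h1
  have hcC : (c : ℂ) ≠ 0 := by exact_mod_cast hc0.ne'
  simp only [Complex.real_smul, Complex.ofReal_inv] at h1 ⊢
  rw [h1]
  field_simp

theorem IsWeakDeriv.mul_smooth {v g : ℝ → ℂ} (h : IsWeakDeriv v g)
    (hv : LocallyIntegrable v volume) (hg : LocallyIntegrable g volume)
    {θ : ℝ → ℝ} (hθ : ContDiff ℝ ∞ θ) :
    IsWeakDeriv (fun x => (θ x : ℂ) * v x)
      (fun x => ((deriv θ x : ℝ) : ℂ) * v x + (θ x : ℂ) * g x) := by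
  intro φ hφ hc
  have hdθ : ContDiff ℝ ∞ (deriv θ) := ((contDiff_infty_iff_deriv (𝕜 := ℝ)).1 hθ).2
  have hdφ : ContDiff ℝ ∞ (deriv φ) := ((contDiff_infty_iff_deriv (𝕜 := ℝ)).1 hφ).2
  have h1 := h (fun x => φ x * θ x) (hφ.mul hθ) hc.mul_right
  have hd : ∀ x, deriv (fun x => φ x * θ x) x = deriv φ x * θ x + φ x * deriv θ x := fun x =>
    deriv_fun_mul (hφ.differentiable (by simp) x) (hθ.differentiable (by simp) x)
  have i1 : Integrable (fun x => (deriv φ x * θ x) • v x) :=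
    hv.integrable_smul_left_of_hasCompactSupport (hdφ.mul hθ).continuous hc.deriv.mul_right
  have i2 : Integrable (fun x => (φ x * deriv θ x) • v x) :=
    hv.integrable_smul_left_of_hasCompactSupport (hφ.mul hdθ).continuous hc.mul_right
  have i3 : Integrable (fun x => (φ x * θ x) • g x) :=
    hg.integrable_smul_left_of_hasCompactSupport (hφ.mul hθ).continuous hc.mul_right
  simp only [hd, add_smul] at h1
  rw [integral_add i1 i2] at h1
  have e1 : ∀ x, deriv φ x • ((θ x : ℂ) * v x) = (deriv φ x * θ x) • v x := fun x => by
    simp only [Complex.real_smul]; push_cast; ring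
  have e2 : ∀ x, φ x • (((deriv θ x : ℝ) : ℂ) * v x + (θ x : ℂ) * g x)
      = (φ x * deriv θ x) • v x + (φ x * θ x) • g x := fun x => by
    simp only [Complex.real_smul]; push_cast; ring
  simp only [e1, e2]
  rw [integral_add i2 i3, neg_add, ← h1]
  ring

/-! ### Pointwise bounds on `H¹` and continuous operations of `H¹` into itself. -/

namespace H1

theorem memLp_dx (v : H1) : MemLp v.dx 2 volume := Lp.memLp _

theorem memLp_rep (v : H1) : MemLp v 2 volume :=
  (memLp_congr_ae v.rep_ae_eq).2 (Lp.memLp _)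

theorem isWeakDeriv_rep (v : H1) : IsWeakDeriv v v.dx :=
  IsWeakDeriv.congr v.2 v.rep_ae_eq.symm (ae_eq_refl _)

theorem norm_dx (v : H1) : ‖v.dx‖ = l2 v.dx := rfl

theorem norm_sq_eq (v : H1) : ‖v‖ ^ 2 = l2 v ^ 2 + l2 v.dx ^ 2 := by
  have : l2 v = ‖v.1.fst‖ := l2_congr v.rep_ae_eq
  rw [this, ← norm_dx]
  exact WithLp.prod_norm_sq_eq_of_L2 v.1

theorem l2_rep_le (v : H1) : l2 v ≤ ‖v‖ := by
  have := v.norm_sq_eq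
  exact (sq_le_sq₀ (l2_nonneg _) (norm_nonneg v)).1 (by nlinarith [sq_nonneg (l2 v.dx)])

theorem l2_dx_le (v : H1) : l2 v.dx ≤ ‖v‖ := by
  have := v.norm_sq_eq
  exact (sq_le_sq₀ (l2_nonneg _) (norm_nonneg v)).1 (by nlinarith [sq_nonneg (l2 v)])

theorem norm_le_l2_add (v : H1) : ‖v‖ ≤ l2 v + l2 v.dx := by
  have := v.norm_sq_eq
  have h1 := l2_nonneg v
  have h2 := l2_nonneg v.dx
  exact (sq_le_sq₀ (norm_nonneg v) (by positivity)).1 (by nlinarith [mul_nonneg h1 h2])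

theorem rep_sub (v w : H1) (x : ℝ) : (v - w) x = v x - w x := by
  have : (v - w).rep = fun x => v x - w x := by
    refine (Continuous.ae_eq_iff_eq volume (v - w).continuous_rep
      (v.continuous_rep.sub w.continuous_rep)).1 ?_
    filter_upwards [(v - w).rep_ae_eq, v.rep_ae_eq, w.rep_ae_eq,
      Lp.coeFn_sub v.1.fst w.1.fst] with x h1 h2 h3 h4
    rw [h1, Pi.sub_apply, h2, h3]
    exact h4
  exact congrFun this x

theorem dx_sub_ae (v w : H1) : (v - w).dx =ᵐ[volume] fun x => v.dx x - w.dx x :=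
  Lp.coeFn_sub v.1.snd w.1.snd

theorem intervalIntegrable_dx (v : H1) (a b : ℝ) : IntervalIntegrable v.dx volume a b :=
  intervalIntegrable_iff.mpr <|
    ((v.memLp_dx.locallyIntegrable (by norm_num)).integrableOn_isCompact isCompact_uIcc).mono_set
      Set.uIoc_subset_uIcc

theorem rep_sub_rep (v : H1) (a b : ℝ) : v b - v a = ∫ t in a..b, v.dx t := by
  have hv : LocallyIntegrable v := v.memLp_rep.locallyIntegrable (by norm_num)
  have hg : LocallyIntegrable v.dx := v.memLp_dx.locallyIntegrable (by norm_num)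
  have hG := isWeakDeriv_primitive v.dx hg
  have hcont : Continuous (fun x => ∫ t in (0 : ℝ)..x, v.dx t) :=
    intervalIntegral.continuous_primitive v.intervalIntegrable_dx 0
  obtain ⟨c, hc⟩ := ae_eq_const_of_isWeakDeriv_zero (fun x => v x - ∫ t in (0 : ℝ)..x, v.dx t)
    (hv.sub hcont.locallyIntegrable) (by
      intro φ hφ hs
      have hdc := hφ.continuous_deriv (by simp)
      simp only [smul_sub]
      rw [integral_sub (hv.integrable_smul_left_of_hasCompactSupport hdc hs.deriv)
        (hcont.locallyIntegrable.integrable_smul_left_of_hasCompactSupport hdc hs.deriv),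
        v.isWeakDeriv_rep φ hφ hs, hG φ hφ hs]
      simp)
  have h := (Continuous.ae_eq_iff_eq volume (v.continuous_rep.sub hcont) continuous_const).1 hc
  have ha := congrFun h a
  have hb := congrFun h b
  simp only [Pi.sub_apply] at ha hb
  rw [← intervalIntegral.integral_interval_sub_left (v.intervalIntegrable_dx 0 b)
    (v.intervalIntegrable_dx 0 a)]
  linear_combination hb - ha

/-- The element of `H¹(ℝ)` with a given continuous representative and weak derivative. -/
def ofWeakDeriv (w g : ℝ → ℂ) (hw : MemLp w 2 volume) (hg : MemLp g 2 volume)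
    (h : IsWeakDeriv w g) : H1 :=
  ⟨WithLp.toLp 2 (hw.toLp w, hg.toLp g),
    IsWeakDeriv.congr h hw.coeFn_toLp.symm hg.coeFn_toLp.symm⟩

theorem ofWeakDeriv_apply {w g : ℝ → ℂ} (hc : Continuous w) (hw : MemLp w 2 volume)
    (hg : MemLp g 2 volume) (h : IsWeakDeriv w g) (x : ℝ) : ofWeakDeriv w g hw hg h x = w x := by
  refine congrFun ((Continuous.ae_eq_iff_eq volume (continuous_rep _) hc).1 ?_) x
  exact (rep_ae_eq _).trans hw.coeFn_toLp

theorem dx_ofWeakDeriv {w g : ℝ → ℂ} (hw : MemLp w 2 volume)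
    (hg : MemLp g 2 volume) (h : IsWeakDeriv w g) : (ofWeakDeriv w g hw hg h).dx =ᵐ[volume] g :=
  hg.coeFn_toLp

theorem intervalIntegral_norm_le_l2 {f : ℝ → ℂ} (hf : MemLp f 2 volume) (x : ℝ) :
    ∫ y in x..(x + 1), ‖f y‖ ≤ l2 f := by
  have hm : MeasurableSet (Set.Ioc x (x + 1)) := measurableSet_Ioc
  have h1 : MemLp ((Set.Ioc x (x + 1)).indicator fun _ => (1 : ℂ)) 2 volume :=
    memLp_indicator_const 2 hm 1 (Or.inr (by simp))
  have h2 := integral_norm_mul_le h1 hf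
  have h3 : l2 ((Set.Ioc x (x + 1)).indicator fun _ => (1 : ℂ)) = 1 := by
    rw [l2, eLpNorm_indicator_const hm (by norm_num) (by norm_num)]
    simp
  rw [h3, one_mul] at h2
  rw [intervalIntegral.integral_of_le (by linarith), ← integral_indicator hm]
  refine le_trans (le_of_eq (integral_congr_ae (Eventually.of_forall fun y => ?_))) h2
  by_cases hy : y ∈ Set.Ioc x (x + 1) <;> simp [hy]

/-- On `[x, x+1]` the value `v x` differs from `v y` by at most the `L¹` norm of the derivative
there, hence by at most its `L²` norm. Averaging over `y` bounds `‖v x‖` by the sum of two `L²`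
norms, whence the factor `2`. -/
theorem norm_apply_le (v : H1) (x : ℝ) : ‖v x‖ ≤ 2 * ‖v‖ := by
  have hi : IntervalIntegrable (fun y => ‖v.dx y‖) volume x (x + 1) :=
    (v.intervalIntegrable_dx x (x + 1)).norm
  have h1 : ∀ y ∈ Set.Icc x (x + 1), ‖v x‖ ≤ ‖v y‖ + l2 v.dx := by
    intro y hy
    have e := v.rep_sub_rep x y
    have h2 : ‖∫ t in x..y, v.dx t‖ ≤ ∫ t in x..(x + 1), ‖v.dx t‖ :=
      (intervalIntegral.norm_integral_le_integral_norm hy.1).trans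
        (intervalIntegral.integral_mono_interval le_rfl hy.1 hy.2
          (Eventually.of_forall fun t => norm_nonneg _) hi)
    have h3 := intervalIntegral_norm_le_l2 v.memLp_dx x
    have h4 : ‖v x‖ ≤ ‖v y‖ + ‖v y - v x‖ := by
      have := norm_sub_le (v y) (v y - v x)
      rwa [sub_sub_cancel] at this
    rw [e] at h4
    linarith
  have hc : Continuous fun y => ‖v y‖ := v.continuous_rep.norm
  have h2 : ∫ _ in x..(x + 1), ‖v x‖ ≤ ∫ y in x..(x + 1), (‖v y‖ + l2 v.dx) :=
    intervalIntegral.integral_mono_on (μ := volume) (by linarith : x ≤ x + 1)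
    (intervalIntegrable_const (c := ‖v x‖))
    ((hc.add continuous_const).intervalIntegrable x (x + 1)) h1
  rw [intervalIntegral.integral_add (hc.intervalIntegrable _ _) intervalIntegrable_const] at h2
  simp only [intervalIntegral.integral_const, add_sub_cancel_left, one_smul] at h2
  linarith [intervalIntegral_norm_le_l2 v.memLp_rep x, v.l2_rep_le, v.l2_dx_le]

theorem continuous_apply (x : ℝ) : Continuous fun v : H1 => v x := by
  refine (LipschitzWith.of_dist_le_mul (K := 2) fun v w => ?_).continuous
  rw [dist_eq_norm, dist_eq_norm, ← rep_sub]
  exact norm_apply_le _ x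

theorem continuous_of_bound {K : H1 → H1} {C : ℝ}
    (h : ∀ v w, ‖K v - K w‖ ≤ C * ‖v - w‖) : Continuous K := by
  refine (LipschitzWith.of_dist_le_mul (K := C.toNNReal) fun v w => ?_).continuous
  rw [dist_eq_norm, dist_eq_norm]
  exact (h v w).trans (by gcongr; exact Real.le_coe_toNNReal C)

/-- Multiplication of the conjugate by a bounded smooth function with bounded derivative. -/
theorem exists_mul_conj {θ : ℝ → ℝ} (hθ : ContDiff ℝ ∞ θ) {A B : ℝ} (hA : ∀ x, |θ x| ≤ A)
    (hB : ∀ x, |deriv θ x| ≤ B) :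
    ∃ K : H1 → H1, Continuous K ∧ (∀ v x, K v x = θ x * (starRingEnd ℂ) (v x)) ∧
      ∀ v, (K v).dx =ᵐ[volume] fun x =>
        ((deriv θ x : ℝ) : ℂ) * (starRingEnd ℂ) (v x) + θ x * (starRingEnd ℂ) (v.dx x) := by
  have hθc := hθ.continuous
  have hdc : Continuous (deriv θ) := hθ.continuous_deriv (by simp)
  have m1 : ∀ v : H1, MemLp (fun x => (θ x : ℂ) * (starRingEnd ℂ) (v x)) 2 volume := fun v =>
    memLp_bdd_mul (memLp_star v.memLp_rep) hθc hA
  have m2 : ∀ v : H1, MemLp (fun x => ((deriv θ x : ℝ) : ℂ) * (starRingEnd ℂ) (v x)) 2 volume := fun v =>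
    memLp_bdd_mul (memLp_star v.memLp_rep) hdc hB
  have m3 : ∀ v : H1, MemLp (fun x => (θ x : ℂ) * (starRingEnd ℂ) (v.dx x)) 2 volume := fun v =>
    memLp_bdd_mul (memLp_star v.memLp_dx) hθc hA
  have hw : ∀ v : H1, IsWeakDeriv (fun x => (θ x : ℂ) * (starRingEnd ℂ) (v x)) (fun x =>
        ((deriv θ x : ℝ) : ℂ) * (starRingEnd ℂ) (v x) + θ x * (starRingEnd ℂ) (v.dx x)) := fun v =>
    v.isWeakDeriv_rep.star.mul_smooth ((memLp_star v.memLp_rep).locallyIntegrable (by norm_num))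
      ((memLp_star v.memLp_dx).locallyIntegrable (by norm_num)) hθ
  let K : H1 → H1 := fun v => ofWeakDeriv _ _ (m1 v) ((m2 v).add (m3 v)) (hw v)
  have hK1 : ∀ v x, K v x = θ x * (starRingEnd ℂ) (v x) := fun v x => by
    have hvc := v.continuous_rep
    exact ofWeakDeriv_apply (by fun_prop) _ _ _ x
  have hK2 : ∀ v, (K v).dx =ᵐ[volume] fun x =>
        ((deriv θ x : ℝ) : ℂ) * (starRingEnd ℂ) (v x) + θ x * (starRingEnd ℂ) (v.dx x) := fun v =>
    dx_ofWeakDeriv _ _ _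
  refine ⟨K, continuous_of_bound (C := A + (B + A)) fun v w => ?_, hK1, hK2⟩
  have hA0 : 0 ≤ A := (abs_nonneg _).trans (hA 0)
  have hB0 : 0 ≤ B := (abs_nonneg _).trans (hB 0)
  have b : ∀ {f : ℝ → ℝ} {C : ℝ} {g : ℝ → ℂ}, (∀ x, |f x| ≤ C) → 0 ≤ C → MemLp g 2 volume →
      l2 (fun x => (f x : ℂ) * (starRingEnd ℂ) (g x)) ≤ C * l2 g := by
    intro f C g hf hC hg
    refine l2_le_mul hg hC (Eventually.of_forall fun x => ?_)
    rw [norm_mul, Complex.norm_real, RCLike.norm_conj]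
    gcongr
    exact hf x
  have e1 : l2 (K v - K w : H1) ≤ A * ‖v - w‖ := by
    have : ((K v - K w : H1) : ℝ → ℂ) = fun x => (θ x : ℂ) * (starRingEnd ℂ) ((v - w : H1) x) := by
      ext x
      rw [rep_sub, hK1, hK1, rep_sub, map_sub]
      ring
    rw [this]
    exact (b hA hA0 (v - w).memLp_rep).trans (by gcongr; exact l2_rep_le _)
  have e2 : l2 (K v - K w : H1).dx ≤ (B + A) * ‖v - w‖ := by
    have : ((K v - K w : H1).dx : ℝ → ℂ) =ᵐ[volume] fun x =>
        ((deriv θ x : ℝ) : ℂ) * (starRingEnd ℂ) ((v - w : H1) x)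
          + (θ x : ℂ) * (starRingEnd ℂ) ((v - w : H1).dx x) := by
      filter_upwards [dx_sub_ae (K v) (K w), dx_sub_ae v w, hK2 v, hK2 w] with x h1 h2 h3 h4
      rw [h1, h2, h3, h4, rep_sub, map_sub, map_sub]
      ring
    rw [l2_congr this]
    refine (l2_add_le (m2 _) (m3 _)).trans ?_
    rw [add_mul]
    gcongr
    · exact (b hB hB0 (v - w).memLp_rep).trans (by gcongr; exact l2_rep_le _)
    · exact (b hA hA0 (v - w).memLp_dx).trans (by gcongr; exact l2_dx_le _)
  refine (norm_le_l2_add _).trans ?_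
  rw [add_mul]
  exact add_le_add e1 e2

/-- Dilation of the conjugate. -/
theorem exists_dilation_conj {c : ℝ} (hc : 0 < c) :
    ∃ K : H1 → H1, Continuous K ∧ (∀ v x, K v x = (starRingEnd ℂ) (v (c * x))) ∧
      ∀ v, (K v).dx =ᵐ[volume] fun x => c * (starRingEnd ℂ) (v.dx (c * x)) := by
  have m1 : ∀ v : H1, MemLp (fun x => (starRingEnd ℂ) (v (c * x))) 2 volume := fun v =>
    memLp_star (MemLp.dilation v.memLp_rep hc)
  have m2 : ∀ v : H1, MemLp (fun x => (c : ℂ) * (starRingEnd ℂ) (v.dx (c * x))) 2 volume := fun v =>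
    (memLp_star (MemLp.dilation v.memLp_dx hc)).const_mul _
  have hw : ∀ v : H1, IsWeakDeriv (fun x => (starRingEnd ℂ) (v (c * x)))
      (fun x => (c : ℂ) * (starRingEnd ℂ) (v.dx (c * x))) := fun v => by
    simpa using (v.isWeakDeriv_rep.dilation hc).star
  let K : H1 → H1 := fun v => ofWeakDeriv _ _ (m1 v) (m2 v) (hw v)
  have hK1 : ∀ v x, K v x = (starRingEnd ℂ) (v (c * x)) := fun v x => by
    have hvc := v.continuous_rep
    exact ofWeakDeriv_apply (by fun_prop) _ _ _ x
  have hK2 : ∀ v, (K v).dx =ᵐ[volume] fun x => c * (starRingEnd ℂ) (v.dx (c * x)) := fun v =>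
    dx_ofWeakDeriv _ _ _
  refine ⟨K, continuous_of_bound (C := c⁻¹ ^ (1 / 2 : ℝ) + c * c⁻¹ ^ (1 / 2 : ℝ)) fun v w => ?_,
    hK1, hK2⟩
  have e1 : l2 (K v - K w : H1) ≤ c⁻¹ ^ (1 / 2 : ℝ) * ‖v - w‖ := by
    have : ((K v - K w : H1) : ℝ → ℂ) = fun x => (starRingEnd ℂ) ((v - w : H1) (c * x)) := by
      ext x
      rw [rep_sub, hK1, hK1, rep_sub, map_sub]
    rw [this, l2_star, l2_dilation (v - w).memLp_rep hc]
    gcongr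
    exact l2_rep_le _
  have e2 : l2 (K v - K w : H1).dx ≤ c * c⁻¹ ^ (1 / 2 : ℝ) * ‖v - w‖ := by
    have : ((K v - K w : H1).dx : ℝ → ℂ) =ᵐ[volume] fun x =>
        (c : ℂ) * (starRingEnd ℂ) ((v - w : H1).dx (c * x)) := by
      filter_upwards [dx_sub_ae (K v) (K w), (quasiMeasurePreserving_mul_left hc.ne').ae
        (dx_sub_ae v w), hK2 v, hK2 w] with x h1 h2 h3 h4
      rw [h1, h2, h3, h4, map_sub]
      ring
    rw [l2_congr this]
    refine (l2_le_mul (memLp_star (MemLp.dilation (v - w).memLp_dx hc)) hc.le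
      (Eventually.of_forall fun x => ?_)).trans ?_
    · rw [norm_mul, Complex.norm_real, Real.norm_of_nonneg hc.le]
    · rw [l2_star, l2_dilation (v - w).memLp_dx hc, mul_assoc]
      gcongr
      exact l2_dx_le _
  refine (norm_le_l2_add _).trans ?_
  rw [add_mul]
  exact add_le_add e1 e2

end H1

/-! ### Time derivatives of quadratic quantities by duality. -/

/-- A product rule without a derivative of `u` in `E`. The increment splits into `(J(u s) - J(u
t))(K(u s))` and `J(u t)(K(u s)) - J(u t)(K(u t))`; the adjointness relation `h` moves the second
difference onto `J ∘ u` as well. Continuity of `K ∘ u` handles the first term, so `K` need not be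
linear, which admits maps involving conjugation. -/
theorem hasDerivWithinAt_pairing {E : Type*} [NormedAddCommGroup E] [NormedSpace ℂ E]
    (J : E → StrongDual ℂ E) {u : ℝ → E} {I : Set ℝ} (hu : ContinuousOn u I)
    (hd : ContDiffOn ℝ 1 (fun s => J (u s)) I) {K K' : E → E} (hK : Continuous K)
    (h : ∀ v w, J v (K w) = (starRingEnd ℂ) (J w (K' v))) {t : ℝ} (ht : t ∈ I) :
    HasDerivWithinAt (fun s => J (u s) (K (u s)))
      (derivWithin (fun s => J (u s)) I t (K (u t))
        + (starRingEnd ℂ) (derivWithin (fun s => J (u s)) I t (K' (u t)))) I t := by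
  have hd' := (hd.differentiableOn one_ne_zero t ht).hasDerivWithinAt
  rw [hasDerivWithinAt_iff_tendsto_slope] at hd' ⊢
  have h2 : Tendsto (fun s => K (u s)) (𝓝[I \ {t}] t) (𝓝 (K (u t))) :=
    (hK.tendsto _).comp ((hu t ht).mono_left (nhdsWithin_mono _ Set.sdiff_subset))
  have happ : Continuous fun z : StrongDual ℂ E × E => z.1 z.2 :=
    isBoundedBilinearMap_apply.continuous
  have h3 := (happ.tendsto _).comp (hd'.prodMk_nhds h2)
  have h4 := (Complex.continuous_conj.tendsto _).comp
    ((happ.tendsto _).comp (hd'.prodMk_nhds (tendsto_const_nhds (x := K' (u t)))))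
  refine (h3.add h4).congr fun s => ?_
  simp only [Function.comp_apply, slope, vsub_eq_sub, _root_.smul_apply,
    _root_.sub_apply, Complex.real_smul, map_mul, map_sub, Complex.conj_ofReal]
  rw [h (u t) (u s), h (u t) (u t)]
  ring

theorem continuousOn_derivWithin_apply {E : Type*} [NormedAddCommGroup E] [NormedSpace ℂ E]
    {U : ℝ → StrongDual ℂ E} {I : Set ℝ} (hI : UniqueDiffOn ℝ I) (hd : ContDiffOn ℝ 1 U I)
    {z : ℝ → E} (hz : ContinuousOn z I) : ContinuousOn (fun t => derivWithin U I t (z t)) I :=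
  (isBoundedBilinearMap_apply (𝕜 := ℂ) (E := E) (F := ℂ)).continuous.comp_continuousOn
    ((hd.continuousOn_derivWithin hI le_rfl).prodMk hz)

/-! ### Integrals of a dilated function against a fixed one. -/

theorem continuousAt_integral_dilation_mul_of_continuous {g w : ℝ → ℂ} (hg : Continuous g)
    (hgc : HasCompactSupport g) (hw : LocallyIntegrable w volume) {c : ℝ} (hc : 0 < c) :
    ContinuousAt (fun μ : ℝ => ∫ x, g (μ * x) * w x) c := by
  obtain ⟨R, hR⟩ : ∃ R : ℝ, 0 < R ∧ tsupport g ⊆ Metric.ball 0 R :=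
    hgc.isBounded.subset_ball_lt 0 0
  obtain ⟨C, hC⟩ := hg.bounded_above_of_compact_support hgc
  have hC0 : 0 ≤ C := (norm_nonneg _).trans (hC 0)
  have hwi : IntegrableOn w (Metric.closedBall 0 (2 * R / c)) :=
    hw.integrableOn_isCompact (isCompact_closedBall _ _)
  -- For `μ > c/2` the function `g (μ * x)` vanishes once `|x| > 2R/c`, so a single compact set
  -- carries all the integrands.
  refine continuousAt_of_dominated
    (bound := (Metric.closedBall (0 : ℝ) (2 * R / c)).indicator fun x => C * ‖w x‖) ?_ ?_ ?_ ?_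
  · refine Eventually.of_forall fun μ => ?_
    exact (hg.comp (by fun_prop : Continuous fun x : ℝ => μ * x)).aestronglyMeasurable.mul
      hw.aestronglyMeasurable
  · filter_upwards [lt_mem_nhds (half_lt_self hc)] with μ hμ
    refine Eventually.of_forall fun x => ?_
    by_cases hx : x ∈ Metric.closedBall (0 : ℝ) (2 * R / c)
    · rw [Set.indicator_of_mem hx, norm_mul]
      gcongr
      exact hC _
    · rw [Set.indicator_of_notMem hx]
      have : g (μ * x) = 0 := by
        refine image_eq_zero_of_notMem_tsupport fun hm => ?_
        have h1 := hR.2 hm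
        rw [mem_ball_zero_iff, norm_mul] at h1
        rw [mem_closedBall_zero_iff, not_le, div_lt_iff₀ hc] at hx
        have h2 : c / 2 ≤ ‖μ‖ := hμ.le.trans (Real.le_norm_self μ)
        have h3 := mul_le_mul_of_nonneg_right h2 (norm_nonneg x)
        linarith
      simp [this]
  · exact (integrable_indicator_iff measurableSet_closedBall).2 (hwi.norm.const_mul C)
  · refine Eventually.of_forall fun x => ?_
    fun_prop

/-- Density of `C_c` in `L²`: for `μ > c/2` dilation by `μ` has norm at most `(c/2)^(-1/2)` on `L²`,
so approximating `g` approximates the integral uniformly near `c`. -/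
theorem continuousAt_integral_dilation_mul {g w : ℝ → ℂ} (hg : MemLp g 2 volume)
    (hw : MemLp w 2 volume) {c : ℝ} (hc : 0 < c) :
    ContinuousAt (fun μ : ℝ => ∫ x, g (μ * x) * w x) c := by
  refine continuousAt_of_locally_uniform_approx_of_continuousAt fun U hU => ?_
  obtain ⟨ε, hε, hεU⟩ := Metric.mem_uniformity_dist.1 hU
  set B : ℝ := (c / 2)⁻¹ ^ (1 / 2 : ℝ) * l2 w with hB
  have hB0 : 0 ≤ B := mul_nonneg (by positivity) (l2_nonneg w)
  -- The denominator is `B + 1` because `B` vanishes when `w` does.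
  obtain ⟨g', hg'c, hg'n, hg'cont, hg'm⟩ := hg.exists_hasCompactSupport_eLpNorm_sub_le
    (by norm_num) (ε := ENNReal.ofReal (ε / (B + 1)))
    (by simp only [ne_eq, ENNReal.ofReal_eq_zero, not_le]; positivity)
  refine ⟨Set.Ioi (c / 2), Ioi_mem_nhds (half_lt_self hc), fun μ => ∫ x, g' (μ * x) * w x,
    continuousAt_integral_dilation_mul_of_continuous hg'cont hg'c
      (hw.locallyIntegrable (by norm_num)) hc, fun μ hμ => hεU ?_⟩
  have hμ' : c / 2 < μ := hμ
  have hμ0 : 0 < μ := (half_pos hc).trans hμ'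
  have hd : MemLp (g - g') 2 volume := hg.sub hg'm
  have hl : l2 (g - g') ≤ ε / (B + 1) := by
    have := ENNReal.toReal_mono ENNReal.ofReal_ne_top hg'n
    rwa [ENNReal.toReal_ofReal (by positivity)] at this
  rw [dist_eq_norm, ← integral_sub (integrable_mul_of_memLp (MemLp.dilation hg hμ0) hw)
    (integrable_mul_of_memLp (MemLp.dilation hg'm hμ0) hw)]
  have e : ∀ x, g (μ * x) * w x - g' (μ * x) * w x = (g - g') (μ * x) * w x := fun x => by
    simp only [Pi.sub_apply]; ring
  simp only [e]
  refine (norm_integral_mul_le (MemLp.dilation hd hμ0) hw).trans_lt ?_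
  rw [l2_dilation hd hμ0]
  have h1 : μ⁻¹ ^ (1 / 2 : ℝ) ≤ (c / 2)⁻¹ ^ (1 / 2 : ℝ) := by
    gcongr
  calc μ⁻¹ ^ (1 / 2 : ℝ) * l2 (g - g') * l2 w
      ≤ (c / 2)⁻¹ ^ (1 / 2 : ℝ) * (ε / (B + 1)) * l2 w := by
        have := l2_nonneg (g - g')
        have := l2_nonneg w
        gcongr
    _ = ε * (B / (B + 1)) := by rw [hB]; ring
    _ < ε * 1 := by
        gcongr
        rw [div_lt_one (by positivity)]
        linarith
    _ = ε := mul_one ε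

theorem continuousOn_integral_dilation_mul {g w : ℝ → ℂ} (hg : MemLp g 2 volume)
    (hw : MemLp w 2 volume) :
    ContinuousOn (fun μ : ℝ => ∫ x, g (μ * x) * w x) (Set.Ioi 0) := fun _ hc =>
  (continuousAt_integral_dilation_mul hg hw hc).continuousWithinAt

/-- The hypothesis of Fubini. Strong measurability of `g` makes `(μ, x) ↦ g (μ * x)` measurable at
once, and `min 1 l > 0` keeps the dilation factor bounded. -/
theorem integrable_dilation_mul_prod {g w : ℝ → ℂ} (hg : MemLp g 2 volume)
    (hgm : StronglyMeasurable g) (hw : MemLp w 2 volume) {l : ℝ} (hl : 0 < l) :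
    Integrable (Function.uncurry fun μ x : ℝ => g (μ * x) * w x)
      ((volume.restrict (Set.uIoc 1 l)).prod volume) := by
  have hm : AEStronglyMeasurable (Function.uncurry fun μ x : ℝ => g (μ * x) * w x)
      ((volume.restrict (Set.uIoc 1 l)).prod volume) := by
    refine AEStronglyMeasurable.mul ?_ hw.1.comp_snd
    exact (hgm.comp_measurable (by fun_prop : Measurable fun z : ℝ × ℝ => z.1 * z.2)
      ).aestronglyMeasurable
  have hmin : 0 < min 1 l := lt_min one_pos hl
  have hmem : ∀ μ ∈ Set.uIoc 1 l, 0 < μ := fun μ hμ => hmin.trans hμ.1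
  refine (integrable_prod_iff hm).2 ⟨?_, ?_⟩
  · refine (ae_restrict_iff' measurableSet_uIoc).2 (Eventually.of_forall fun μ hμ => ?_)
    exact integrable_mul_of_memLp (MemLp.dilation hg (hmem μ hμ)) hw
  · have : IsFiniteMeasure (volume.restrict (Set.uIoc 1 l)) :=
      ⟨by simp [Set.uIoc]⟩
    refine Integrable.of_bound hm.norm.integral_prod_right'
      ((min 1 l)⁻¹ ^ (1 / 2 : ℝ) * l2 g * l2 w)
      ((ae_restrict_iff' measurableSet_uIoc).2 (Eventually.of_forall fun μ hμ => ?_))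
    rw [Real.norm_of_nonneg (integral_nonneg fun x => norm_nonneg _)]
    refine (integral_norm_mul_le (MemLp.dilation hg (hmem μ hμ)) hw).trans ?_
    rw [l2_dilation hg (hmem μ hμ)]
    have : min 1 l ≤ μ := hμ.1.le
    have := l2_nonneg g
    have := l2_nonneg w
    have := hmem μ hμ
    gcongr

/-- Writing `u(lx) - u(x)` as the integral of `x u'(μx)` over `μ`, then exchanging integrals. The
weight `x` falls on `v`, so `u` needs no decay beyond `H¹`. -/
theorem integral_dilation_mul_sub (u : H1) {v : ℝ → ℂ} (hv : MemLp v 2 volume)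
    (hxv : MemLp (fun x : ℝ => (x : ℂ) * v x) 2 volume) {l : ℝ} (hl : 0 < l) :
    (∫ x, u (l * x) * v x) - ∫ x, u x * v x
      = ∫ μ in (1 : ℝ)..l, ∫ x, u.dx (μ * x) * ((x : ℂ) * v x) := by
  rw [← integral_sub (integrable_mul_of_memLp (MemLp.dilation u.memLp_rep hl) hv)
    (integrable_mul_of_memLp u.memLp_rep hv)]
  have e : ∀ x : ℝ, u (l * x) * v x - u x * v x
      = ∫ μ in (1 : ℝ)..l, u.dx (μ * x) * ((x : ℂ) * v x) := by
    intro x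
    have h1 := u.rep_sub_rep x (l * x)
    have h2 := intervalIntegral.smul_integral_comp_mul_left (a := 1) (b := l) u.dx x
    rw [mul_one, mul_comm x l] at h2
    rw [← h2] at h1
    rw [intervalIntegral.integral_mul_const, ← sub_mul, h1, Complex.real_smul]
    simp only [mul_comm x]
    ring
  simp only [e]
  simp only [intervalIntegral.intervalIntegral_eq_integral_uIoc]
  rw [integral_smul]
  congr 1
  exact (integral_integral_swap
    (integrable_dilation_mul_prod u.memLp_dx (Lp.stronglyMeasurable _) hxv hl)).symm

theorem hasDerivAt_integral_dilation_mul (u : H1) {v : ℝ → ℂ} (hv : MemLp v 2 volume)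
    (hxv : MemLp (fun x : ℝ => (x : ℂ) * v x) 2 volume) :
    HasDerivAt (fun l : ℝ => ∫ x, u (l * x) * v x) (∫ x, u.dx x * ((x : ℂ) * v x)) 1 := by
  have hc := continuousOn_integral_dilation_mul u.memLp_dx hxv
  have h1 := intervalIntegral.integral_hasDerivAt_right (a := (1 : ℝ)) (b := 1)
    (f := fun μ : ℝ => ∫ x, u.dx (μ * x) * ((x : ℂ) * v x)) (by simp)
    (hc.stronglyMeasurableAtFilter isOpen_Ioi 1 (Set.mem_Ioi.2 one_pos))
    (continuousAt_integral_dilation_mul u.memLp_dx hxv one_pos)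
  simp only [one_mul] at h1
  refine (h1.const_add (∫ x, u x * v x)).congr_of_eventuallyEq ?_
  filter_upwards [lt_mem_nhds (zero_lt_one (α := ℝ))] with l hl
  rw [← integral_dilation_mul_sub u hv hxv hl]
  ring

theorem norm_integral_dilation_mul_sub_le (u : H1) {v : ℝ → ℂ} (hv : MemLp v 2 volume)
    (hxv : MemLp (fun x : ℝ => (x : ℂ) * v x) 2 volume) {l : ℝ} (hl : 1 / 2 ≤ l) :
    ‖(∫ x, u (l * x) * v x) - ∫ x, u x * v x‖
      ≤ 2 * l2 u.dx * l2 (fun x : ℝ => (x : ℂ) * v x) * |l - 1| := by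
  rw [integral_dilation_mul_sub u hv hxv (by linarith)]
  refine intervalIntegral.norm_integral_le_of_norm_le_const fun μ hμ => ?_
  have hμ2 : 1 / 2 ≤ μ := (le_min (by norm_num) hl).trans hμ.1.le
  have hμ0 : 0 < μ := by linarith
  refine (norm_integral_mul_le (MemLp.dilation u.memLp_dx hμ0) hxv).trans ?_
  rw [l2_dilation u.memLp_dx hμ0]
  have h1 : μ⁻¹ ≤ 2 := by
    rw [inv_le_comm₀ hμ0 two_pos]; linarith
  have h2 : μ⁻¹ ^ (1 / 2 : ℝ) ≤ 2 := by
    calc μ⁻¹ ^ (1 / 2 : ℝ) ≤ 2 ^ (1 / 2 : ℝ) := by gcongr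
      _ ≤ 2 ^ (1 : ℝ) := Real.rpow_le_rpow_of_exponent_le (by norm_num) (by norm_num)
      _ = 2 := Real.rpow_one 2
  have := l2_nonneg u.dx
  have := l2_nonneg (fun x : ℝ => (x : ℂ) * v x)
  gcongr

/-! ### Energy correlations under dilation and their behaviour at `c = 1`. -/

/-- The nonlinearity `|u|^(p-1) u`. -/
def nonlin (p : ℝ) (u : H1) (x : ℝ) : ℂ := ((‖u x‖ ^ (p - 1) : ℝ) : ℂ) * u x

/-- `‖u‖_{p+1}^{p+1}`. -/
def potential (p : ℝ) (u : H1) : ℝ := ∫ x, ‖u x‖ ^ (p + 1)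

/-- The momentum weighted by `x`. -/
def weightedMomentum (u : H1) : ℝ :=
  (∫ x : ℝ, (starRingEnd ℂ) (u x) * (x : ℂ) * u.dx x).im

/-- `Re ∫ u(cx) |u|^(p-1) ū dx`. -/
def potentialCorrelation (p : ℝ) (u : H1) (c : ℝ) : ℝ :=
  (∫ x, u (c * x) * (starRingEnd ℂ) (nonlin p u x)).re

/-- `Re ∫ ∂ₓu(cx) ∂ₓū dx`. -/
def kineticCorrelation (u : H1) (c : ℝ) : ℝ :=
  (∫ x, u.dx (c * x) * (starRingEnd ℂ) (u.dx x)).re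

/-- The real part of the pairing of `-∂ₓ²u - γ δ u - |u|^(p-1) u` with `x ↦ ū(cx)`. -/
def energyCorrelation (γ p : ℝ) (u : H1) (c : ℝ) : ℝ :=
  c * kineticCorrelation u c - γ * ‖u 0‖ ^ 2 - potentialCorrelation p u c

theorem continuous_nonlin {p : ℝ} (hp : 1 < p) (u : H1) : Continuous (nonlin p u) := by
  have hc := u.continuous_rep
  have h1 : Continuous fun x => ‖u x‖ ^ (p - 1) :=
    hc.norm.rpow_const fun x => Or.inr (by linarith)
  exact (Complex.continuous_ofReal.comp h1).mul hc

theorem norm_nonlin {p : ℝ} (hp : 1 < p) (u : H1) (x : ℝ) : ‖nonlin p u x‖ = ‖u x‖ ^ p := by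
  rw [nonlin, norm_mul, Complex.norm_real, Real.norm_of_nonneg (by positivity),
    ← Real.rpow_add_one' (norm_nonneg _) (by linarith)]
  congr 1
  ring

theorem norm_nonlin_le {p : ℝ} (hp : 1 < p) (u : H1) (x : ℝ) : ‖nonlin p u x‖ ≤ (2 * ‖u‖) ^ (p - 1) * ‖u x‖ := by
  rw [nonlin, norm_mul, Complex.norm_real, Real.norm_of_nonneg (by positivity)]
  gcongr
  exact u.norm_apply_le x

theorem memLp_nonlin {p : ℝ} (hp : 1 < p) (u : H1) : MemLp (nonlin p u) 2 volume :=
  u.memLp_rep.of_le_mul (continuous_nonlin hp u).aestronglyMeasurable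
    (Eventually.of_forall (norm_nonlin_le hp u))

theorem norm_conj_nonlin_weighted_le {p : ℝ} (hp : 1 < p) (u : H1) (x : ℝ) :
    ‖(x : ℂ) * (starRingEnd ℂ) (nonlin p u x)‖ ≤ (2 * ‖u‖) ^ (p - 1) * ‖(x : ℂ) * u x‖ := by
  rw [norm_mul, norm_mul, RCLike.norm_conj, mul_left_comm]
  gcongr
  exact norm_nonlin_le hp u x

theorem memLp_weighted_conj_nonlin {p : ℝ} (hp : 1 < p) (u : H1) (hxu : MemLp (fun x : ℝ => (x : ℂ) * u x) 2 volume) :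
    MemLp (fun x : ℝ => (x : ℂ) * (starRingEnd ℂ) (nonlin p u x)) 2 volume := by
  have hc := continuous_nonlin hp u
  exact hxu.of_le_mul (by fun_prop) (Eventually.of_forall (norm_conj_nonlin_weighted_le hp u))

theorem l2_weighted_conj_nonlin_le {p : ℝ} (hp : 1 < p) (u : H1) (hxu : MemLp (fun x : ℝ => (x : ℂ) * u x) 2 volume) :
    l2 (fun x : ℝ => (x : ℂ) * (starRingEnd ℂ) (nonlin p u x))
      ≤ (2 * ‖u‖) ^ (p - 1) * l2 (fun x : ℝ => (x : ℂ) * u x) :=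
  l2_le_mul hxu (by positivity) (Eventually.of_forall (norm_conj_nonlin_weighted_le hp u))

theorem norm_rpow_eq {p : ℝ} (hp : 1 < p) (u : H1) (x : ℝ) : ‖u x‖ ^ (p + 1) = ‖u x‖ ^ (p - 1) * ‖u x‖ ^ 2 := by
  rw [show p + 1 = (p - 1) + 2 by ring, Real.rpow_add' (norm_nonneg _) (by linarith)]
  norm_num

theorem norm_rpow_le {p : ℝ} (hp : 1 < p) (u : H1) (x : ℝ) : ‖u x‖ ^ (p + 1) ≤ (2 * ‖u‖) ^ (p - 1) * ‖u x‖ ^ 2 := by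
  rw [norm_rpow_eq hp]
  gcongr
  exact u.norm_apply_le x

theorem integrable_norm_rpow {p : ℝ} (hp : 1 < p) (u : H1) : Integrable fun x => ‖u x‖ ^ (p + 1) := by
  refine ((u.memLp_rep.integrable_norm_pow (by norm_num)).const_mul ((2 * ‖u‖) ^ (p - 1))).mono'
    ?_ (Eventually.of_forall fun x => ?_)
  · have : Continuous fun x => ‖u x‖ ^ (p + 1) :=
      u.continuous_rep.norm.rpow_const fun x => Or.inr (by linarith)
    exact this.aestronglyMeasurable
  · rw [Real.norm_of_nonneg (by positivity)]
    exact norm_rpow_le hp u x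

theorem potential_nonneg (p : ℝ) (u : H1) : 0 ≤ potential p u := integral_nonneg fun x => by positivity

theorem potential_le {p : ℝ} (hp : 1 < p) (u : H1) : potential p u ≤ (2 * ‖u‖) ^ (p - 1) * ‖u‖ ^ 2 := by
  have h : potential p u ≤ ∫ x, (2 * ‖u‖) ^ (p - 1) * ‖u x‖ ^ 2 :=
    integral_mono (integrable_norm_rpow hp u)
      ((u.memLp_rep.integrable_norm_pow (by norm_num)).const_mul _) (norm_rpow_le hp u)
  rw [integral_const_mul, ← l2_sq u.memLp_rep] at h
  refine h.trans ?_
  have := l2_nonneg u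
  have := u.l2_rep_le
  gcongr

theorem potentialCorrelation_one {p : ℝ} (hp : 1 < p) (u : H1) : potentialCorrelation p u 1 = potential p u := by
  have : ∀ x, u (1 * x) * (starRingEnd ℂ) (nonlin p u x) = ((‖u x‖ ^ (p + 1) : ℝ) : ℂ) := by
    intro x
    rw [one_mul, norm_rpow_eq hp, nonlin, map_mul, Complex.conj_ofReal, mul_left_comm,
      Complex.mul_conj']
    push_cast
    rfl
  simp only [potentialCorrelation, this]
  rw [integral_complex_ofReal, Complex.ofReal_re, potential]

/-- Young's inequality with exponents `p+1` and `(p+1)/p`, followed by rescaling the dilated term.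
Equality holds at `c = 1`, which is what makes the bound useful for a derivative. -/
theorem potentialCorrelation_le {p : ℝ} (hp : 1 < p) (u : H1) {c : ℝ} (hc : 0 < c) :
    potentialCorrelation p u c ≤ p / (p + 1) * potential p u + potential p u / (p + 1) * c⁻¹ := by
  have hp0 : 0 < p := by linarith
  have hq : (p + 1).HolderConjugate ((p + 1) / p) := by
    rw [Real.holderConjugate_iff]
    refine ⟨by linarith, ?_⟩
    field_simp
    ring
  have i1 := integrable_norm_rpow hp u
  have i2 : Integrable fun x => ‖u (c * x)‖ ^ (p + 1) := i1.comp_mul_left' hc.ne'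
  have hm : MemLp (fun x => (starRingEnd ℂ) (nonlin p u x)) 2 volume := memLp_star (memLp_nonlin hp u)
  have i3 := integrable_mul_of_memLp (MemLp.dilation u.memLp_rep hc) hm
  have h1 : ∀ x, (u (c * x) * (starRingEnd ℂ) (nonlin p u x)).re
      ≤ (1 / (p + 1)) * ‖u (c * x)‖ ^ (p + 1) + (p / (p + 1)) * ‖u x‖ ^ (p + 1) := by
    intro x
    refine (Complex.re_le_norm _).trans ?_
    rw [norm_mul, RCLike.norm_conj, norm_nonlin hp]
    refine (Real.young_inequality_of_nonneg (norm_nonneg _) (by positivity) hq).trans (le_of_eq ?_)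
    rw [← Real.rpow_mul (norm_nonneg _), mul_div_cancel₀ _ hp0.ne']
    field_simp
  have h2 := integral_mono i3.re ((i2.const_mul (1 / (p + 1))).add (i1.const_mul (p / (p + 1)))) h1
  have h3 : ∫ x, ‖u (c * x)‖ ^ (p + 1) = c⁻¹ * potential p u := by
    have := Measure.integral_comp_mul_left (fun y => ‖u y‖ ^ (p + 1)) c
    rwa [abs_of_pos (inv_pos.2 hc), smul_eq_mul] at this
  have h4 : potentialCorrelation p u c = ∫ x, (u (c * x) * (starRingEnd ℂ) (nonlin p u x)).re :=
    (integral_re i3).symm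
  have h5 : ∫ x, ((1 / (p + 1)) * ‖u (c * x)‖ ^ (p + 1) + (p / (p + 1)) * ‖u x‖ ^ (p + 1))
      = (1 / (p + 1)) * (c⁻¹ * potential p u) + (p / (p + 1)) * potential p u := by
    rw [integral_add (i2.const_mul _) (i1.const_mul _), integral_const_mul, integral_const_mul, h3,
      potential]
  rw [h4]
  refine h2.trans (le_of_eq (h5.trans ?_))
  ring

/-- The derivative exists by the dilation formula, with weight on the nonlinearity. Its value needs
no chain rule for `|u|^(p+1)`: the Young majorant touches the function from above at `1`, so both
have the same derivative there. -/
theorem hasDerivAt_potentialCorrelation {p : ℝ} (hp : 1 < p) (u : H1) (hxu : MemLp (fun x : ℝ => (x : ℂ) * u x) 2 volume) :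
    HasDerivAt (potentialCorrelation p u) (-(potential p u / (p + 1))) 1 := by
  have h1 := hasDerivAt_integral_dilation_mul u (memLp_star (memLp_nonlin hp u))
    (memLp_weighted_conj_nonlin hp u hxu)
  have h2 : HasDerivAt (potentialCorrelation p u) _ 1 := Complex.reCLM.hasFDerivAt.comp_hasDerivAt 1 h1
  have h3 : HasDerivAt (fun c : ℝ => p / (p + 1) * potential p u + potential p u / (p + 1) * c⁻¹)
      (-(potential p u / (p + 1))) 1 := by
    have := ((hasDerivAt_inv (one_ne_zero (α := ℝ))).const_mul (potential p u / (p + 1))).const_add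
      (p / (p + 1) * potential p u)
    simpa using this
  have hmax : IsLocalMax (fun c => potentialCorrelation p u c
      - (p / (p + 1) * potential p u + potential p u / (p + 1) * c⁻¹)) 1 := by
    filter_upwards [lt_mem_nhds (zero_lt_one (α := ℝ))] with c hc
    have h4 := potentialCorrelation_le hp u hc
    rw [potentialCorrelation_one hp]
    have : p / (p + 1) * potential p u + potential p u / (p + 1) * 1⁻¹ = potential p u := by
      field_simp
    linarith
  have h0 := hmax.hasDerivAt_eq_zero (h2.sub h3)
  rw [← sub_eq_zero.1 h0]
  exact h2

theorem abs_potentialCorrelation_sub_le {p : ℝ} (hp : 1 < p) (u : H1) (hxu : MemLp (fun x : ℝ => (x : ℂ) * u x) 2 volume)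
    {c : ℝ} (hc : 1 / 2 ≤ c) :
    |potentialCorrelation p u c - potential p u|
      ≤ 2 * ‖u‖ * ((2 * ‖u‖) ^ (p - 1) * l2 (fun x : ℝ => (x : ℂ) * u x)) * |c - 1| := by
  have h1 := norm_integral_dilation_mul_sub_le u (memLp_star (memLp_nonlin hp u))
    (memLp_weighted_conj_nonlin hp u hxu) hc
  have h2 := (Complex.abs_re_le_norm _).trans h1
  have h3 := potentialCorrelation_one hp u
  simp only [potentialCorrelation, one_mul] at h3
  rw [Complex.sub_re, h3] at h2
  refine h2.trans ?_
  have := u.l2_dx_le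
  have := l2_weighted_conj_nonlin_le hp u hxu
  have := l2_nonneg (fun x : ℝ => (x : ℂ) * (starRingEnd ℂ) (nonlin p u x))
  gcongr

theorem kineticCorrelation_one (u : H1) : kineticCorrelation u 1 = ‖u.dx‖ ^ 2 := by
  simp only [kineticCorrelation, one_mul, Complex.mul_conj']
  rw [H1.norm_dx, l2_sq u.memLp_dx]
  norm_cast

theorem continuousAt_kineticCorrelation (u : H1) : ContinuousAt (kineticCorrelation u) 1 :=
  Complex.continuous_re.continuousAt.comp
    (continuousAt_integral_dilation_mul u.memLp_dx (memLp_star u.memLp_dx) one_pos)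

theorem abs_kineticCorrelation_le (u : H1) {c : ℝ} (hc : 1 ≤ c) :
    |kineticCorrelation u c| ≤ ‖u‖ ^ 2 := by
  have hc0 : 0 < c := by linarith
  refine (Complex.abs_re_le_norm _).trans ((norm_integral_mul_le (MemLp.dilation u.memLp_dx hc0)
    (memLp_star u.memLp_dx)).trans ?_)
  rw [l2_star, l2_dilation u.memLp_dx hc0]
  have h1 : c⁻¹ ^ (1 / 2 : ℝ) ≤ 1 :=
    Real.rpow_le_one (by positivity) (inv_le_one_of_one_le₀ hc) (by norm_num)
  have h2 := u.l2_dx_le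
  have h3 := l2_nonneg u.dx
  calc c⁻¹ ^ (1 / 2 : ℝ) * l2 u.dx * l2 u.dx ≤ 1 * ‖u‖ * ‖u‖ := by gcongr
    _ = ‖u‖ ^ 2 := by ring

theorem kineticCorrelation_inv (u : H1) {c : ℝ} (hc : 0 < c) :
    kineticCorrelation u c⁻¹ = c * kineticCorrelation u c := by
  have h := Measure.integral_comp_mul_left
    (fun y => u.dx (c⁻¹ * y) * (starRingEnd ℂ) (u.dx y)) c
  simp only [inv_mul_cancel_left₀ hc.ne', abs_of_pos (inv_pos.2 hc)] at h
  have h2 : kineticCorrelation u c = c⁻¹ * kineticCorrelation u c⁻¹ := by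
    have := congrArg Complex.re h
    rw [Complex.real_smul, Complex.re_ofReal_mul] at this
    rw [kineticCorrelation, kineticCorrelation, ← this, ← Complex.conj_re, ← integral_conj]
    simp [mul_comm]
  rw [h2, mul_inv_cancel_left₀ hc.ne']

/-- The scaling symmetry `kineticCorrelation_inv` merges the two kinetic terms into one with the
vanishing factor `c - c⁻¹`. Hence continuity of the kinetic correlation at `1` suffices in the
limit. -/
theorem energyCorrelation_sub (γ p : ℝ) (u : H1) {c : ℝ} (hc : 0 < c) :
    energyCorrelation γ p u c - c⁻¹ * energyCorrelation γ p u c⁻¹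
      = (c - c⁻¹) * kineticCorrelation u c - γ * ‖u 0‖ ^ 2 * (1 - c⁻¹)
        - (potentialCorrelation p u c - c⁻¹ * potentialCorrelation p u c⁻¹) := by
  simp only [energyCorrelation, kineticCorrelation_inv u hc]
  field_simp
  ring

theorem tendsto_energyCorrelation_sub_div (γ : ℝ) {p : ℝ} (hp : 1 < p) (u : H1)
    (hxu : MemLp (fun x : ℝ => (x : ℂ) * u x) 2 volume) :
    Tendsto (fun c => (c - 1)⁻¹ *
        (energyCorrelation γ p u c - c⁻¹ * energyCorrelation γ p u c⁻¹))
      (𝓝[>] 1) (𝓝 (2 * Q γ p u)) := by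
  have hX := hasDerivAt_potentialCorrelation hp u hxu
  have hinv : HasDerivAt (fun c : ℝ => c⁻¹) (-1) 1 := by
    simpa using hasDerivAt_inv (one_ne_zero (α := ℝ))
  have hX' : HasDerivAt (fun c : ℝ => potentialCorrelation p u c⁻¹)
      (-(potential p u / (p + 1)) * (-1)) 1 := by
    refine HasDerivAt.comp (1 : ℝ) (h₂ := potentialCorrelation p u) ?_ hinv
    rwa [inv_one]
  have hY := hX.sub (hinv.mul hX')
  have hYs := (hasDerivAt_iff_tendsto_slope.1 hY).mono_left
    (nhdsWithin_mono (1 : ℝ) (fun c (hc : 1 < c) => ne_of_gt hc))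
  have hA : Tendsto (kineticCorrelation u) (𝓝[>] 1) (𝓝 (‖u.dx‖ ^ 2)) := by
    rw [← kineticCorrelation_one]
    exact (continuousAt_kineticCorrelation u).mono_left nhdsWithin_le_nhds
  have hi : Tendsto (fun c : ℝ => c⁻¹) (𝓝[>] 1) (𝓝 1) := by
    have := hinv.continuousAt.tendsto.mono_left (nhdsWithin_le_nhds (s := Set.Ioi 1))
    simpa using this
  have h := (((hi.const_add 1).mul hA).sub (hi.const_mul (γ * ‖u 0‖ ^ 2))).sub hYs
  have e : (1 + 1) * ‖u.dx‖ ^ 2 - γ * ‖u 0‖ ^ 2 * 1 - (-(potential p u / (p + 1)) -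
      (-1 * potentialCorrelation p u 1⁻¹ + 1⁻¹ * (-(potential p u / (p + 1)) * -1)))
        = 2 * Q γ p u := by
    rw [inv_one, potentialCorrelation_one hp, Q, ← potential]
    field_simp
    ring
  rw [e] at h
  refine h.congr' ?_
  filter_upwards [self_mem_nhdsWithin] with c hc
  have hc1 : (1 : ℝ) < c := hc
  have hc0 : c ≠ 0 := by positivity
  have hc2 : c - 1 ≠ 0 := sub_ne_zero.2 hc1.ne'
  rw [energyCorrelation_sub γ p u (by positivity)]
  simp only [slope, vsub_eq_sub, smul_eq_mul, Pi.sub_apply, Pi.mul_apply, inv_one, one_mul,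
    sub_self, sub_zero]
  field_simp
  ring

/-- Domination for the limit `c ↓ 1` under the time integral: the bound depends on `u` only through
`m` and `r`, and not on `c`. The restriction `c ≤ 2` keeps `c⁻¹ ≥ 1/2`, where the Lipschitz estimate
of the potential correlation applies. -/
theorem abs_energyCorrelation_sub_div_le (γ : ℝ) {p : ℝ} (hp : 1 < p) (u : H1)
    (hxu : MemLp (fun x : ℝ => (x : ℂ) * u x) 2 volume) {m r c : ℝ} (hm : ‖u‖ ≤ m)
    (hr : l2 (fun x : ℝ => (x : ℂ) * u x) ≤ r) (hc1 : 1 < c) (hc2 : c ≤ 2) :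
    |(c - 1)⁻¹ * (energyCorrelation γ p u c - c⁻¹ * energyCorrelation γ p u c⁻¹)|
      ≤ 2 * m ^ 2 + |γ| * (2 * m) ^ 2
        + (2 * (2 * m * ((2 * m) ^ (p - 1) * r)) + (2 * m) ^ (p - 1) * m ^ 2) := by
  have hc0 : 0 < c := by linarith
  have hcm : 0 < c - 1 := by linarith
  have hm0 : 0 ≤ m := (norm_nonneg u).trans hm
  have hl := l2_nonneg (fun x : ℝ => (x : ℂ) * u x)
  have hr0 : 0 ≤ r := hl.trans hr
  have hci : c⁻¹ ≤ 1 := inv_le_one_of_one_le₀ hc1.le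
  have hci0 : 0 < c⁻¹ := inv_pos.2 hc0
  have hcd : 1 - c⁻¹ ≤ c - 1 := by
    have : 1 - c⁻¹ = (c - 1) * c⁻¹ := by field_simp
    rw [this]
    exact mul_le_of_le_one_right hcm.le hci
  have hch : 1 / 2 ≤ c⁻¹ := by
    rw [one_div]
    exact inv_anti₀ hc0 hc2
  set B := 2 * m * ((2 * m) ^ (p - 1) * r) with hB
  have hB0 : 0 ≤ B := by positivity
  have hX : ∀ d : ℝ, 1 / 2 ≤ d → |potentialCorrelation p u d - potential p u| ≤ B * |d - 1| := by
    intro d hd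
    refine (abs_potentialCorrelation_sub_le hp u hxu hd).trans ?_
    rw [hB]
    gcongr
  have hX1 := hX c (by linarith)
  have hX2 := hX c⁻¹ hch
  rw [abs_of_pos hcm] at hX1
  rw [abs_sub_comm c⁻¹ 1, abs_of_nonneg (sub_nonneg.2 hci)] at hX2
  have hS0 := potential_nonneg p u
  have hS : potential p u ≤ (2 * m) ^ (p - 1) * m ^ 2 := by
    refine (potential_le hp u).trans ?_
    gcongr
  have hA : |kineticCorrelation u c| ≤ m ^ 2 :=
    (abs_kineticCorrelation_le u hc1.le).trans (by gcongr)
  have hd : ‖u 0‖ ^ 2 ≤ (2 * m) ^ 2 := by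
    have := u.norm_apply_le 0
    gcongr
    linarith
  rw [abs_mul, abs_of_pos (inv_pos.2 hcm), inv_mul_le_iff₀ hcm, energyCorrelation_sub γ p u hc0]
  have t1 : |(c - c⁻¹) * kineticCorrelation u c| ≤ (c - 1) * (2 * m ^ 2) := by
    rw [abs_mul, abs_of_nonneg (by linarith)]
    calc (c - c⁻¹) * |kineticCorrelation u c| ≤ (2 * (c - 1)) * m ^ 2 := by
          gcongr
          linarith
      _ = _ := by ring
  have t2 : |γ * ‖u 0‖ ^ 2 * (1 - c⁻¹)| ≤ (c - 1) * (|γ| * (2 * m) ^ 2) := by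
    rw [abs_mul, abs_mul, abs_of_nonneg (by linarith : 0 ≤ 1 - c⁻¹),
      abs_of_nonneg (by positivity : 0 ≤ ‖u 0‖ ^ 2), mul_comm]
    have : 0 ≤ 1 - c⁻¹ := by linarith
    gcongr
  have t3 : |potentialCorrelation p u c - c⁻¹ * potentialCorrelation p u c⁻¹|
      ≤ (c - 1) * (2 * B + (2 * m) ^ (p - 1) * m ^ 2) := by
    have e : potentialCorrelation p u c - c⁻¹ * potentialCorrelation p u c⁻¹
        = (potentialCorrelation p u c - potential p u)
          - c⁻¹ * (potentialCorrelation p u c⁻¹ - potential p u) + (1 - c⁻¹) * potential p u := by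
      ring
    rw [e]
    have a1 : |c⁻¹ * (potentialCorrelation p u c⁻¹ - potential p u)| ≤ B * (c - 1) := by
      rw [abs_mul, abs_of_pos hci0]
      calc c⁻¹ * |potentialCorrelation p u c⁻¹ - potential p u| ≤ 1 * (B * (c - 1)) := by
            gcongr
            exact hX2.trans (by gcongr)
        _ = _ := one_mul _
    have a2 : |(1 - c⁻¹) * potential p u| ≤ (c - 1) * ((2 * m) ^ (p - 1) * m ^ 2) := by
      rw [abs_mul, abs_of_nonneg (by linarith : 0 ≤ 1 - c⁻¹), abs_of_nonneg hS0]
      gcongr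
    have a3 := abs_add_le ((potentialCorrelation p u c - potential p u)
          - c⁻¹ * (potentialCorrelation p u c⁻¹ - potential p u)) ((1 - c⁻¹) * potential p u)
    have a4 := abs_sub (potentialCorrelation p u c - potential p u)
      (c⁻¹ * (potentialCorrelation p u c⁻¹ - potential p u))
    linarith
  have a1 := abs_sub ((c - c⁻¹) * kineticCorrelation u c - γ * ‖u 0‖ ^ 2 * (1 - c⁻¹))
    (potentialCorrelation p u c - c⁻¹ * potentialCorrelation p u c⁻¹)
  have a2 := abs_sub ((c - c⁻¹) * kineticCorrelation u c) (γ * ‖u 0‖ ^ 2 * (1 - c⁻¹))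
  linarith

/-! ### The weighted momentum as a derivative along dilations. -/

theorem memLp_weighted_conj (u : H1) (hxu : MemLp (fun x : ℝ => (x : ℂ) * u x) 2 volume) :
    MemLp (fun x : ℝ => (x : ℂ) * (starRingEnd ℂ) (u x)) 2 volume := by
  simpa using memLp_star hxu

theorem integrable_weightedMomentum (u : H1)
    (hxu : MemLp (fun x : ℝ => (x : ℂ) * u x) 2 volume) :
    Integrable (fun x : ℝ => (starRingEnd ℂ) (u x) * (x : ℂ) * u.dx x) := by
  refine (integrable_mul_of_memLp (memLp_weighted_conj u hxu) u.memLp_dx).congr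
    (Eventually.of_forall fun x => ?_)
  simp only
  ring

theorem tendsto_im_dilation_div (u : H1) (hxu : MemLp (fun x : ℝ => (x : ℂ) * u x) 2 volume) :
    Tendsto (fun c => (c - 1)⁻¹ * (∫ x, u (c * x) * (starRingEnd ℂ) (u x)).im)
      (𝓝[>] 1) (𝓝 (weightedMomentum u)) := by
  have h1 := hasDerivAt_integral_dilation_mul u (memLp_star u.memLp_rep) (memLp_weighted_conj u hxu)
  have h2 := Complex.imCLM.hasFDerivAt.comp_hasDerivAt 1 h1
  have h3 := (hasDerivAt_iff_tendsto_slope.1 h2).mono_left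
    (nhdsWithin_mono (1 : ℝ) (fun c (hc : 1 < c) => ne_of_gt hc))
  have e : Complex.imCLM (∫ x, u.dx x * ((x : ℂ) * (starRingEnd ℂ) (u x)))
      = weightedMomentum u := by
    rw [weightedMomentum, Complex.imCLM_apply]
    congr 2
    ext x
    ring
  rw [e] at h3
  refine h3.congr fun c => ?_
  -- At `c = 1` the integral is the real number `‖u‖₂²`, so the difference quotient has no
  -- subtracted term.
  have h0 : (∫ x, u x * (starRingEnd ℂ) (u x)).im = 0 := by
    simp only [Complex.mul_conj']
    norm_cast
  simp [slope, h0]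

/-! ### Calculus on `[0, T)`. -/

section TimeInterval

theorem zero_mem_timeInterval {T : EReal} (hT : 0 < T) : (0 : ℝ) ∈ timeInterval T :=
  ⟨le_rfl, by simpa using hT⟩

theorem Icc_subset_timeInterval {T : EReal} {t : ℝ} (ht : t ∈ timeInterval T) :
    Set.Icc 0 t ⊆ timeInterval T := fun _ hs =>
  ⟨hs.1, lt_of_le_of_lt (EReal.coe_le_coe_iff.2 hs.2) ht.2⟩

theorem exists_gt_mem_timeInterval {T : EReal} {t : ℝ} (ht : t ∈ timeInterval T) :
    ∃ b ∈ timeInterval T, t < b := by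
  obtain ⟨b, h1, h2⟩ := EReal.lt_iff_exists_real_btwn.1 ht.2
  have h3 : t < b := EReal.coe_lt_coe_iff.1 h1
  exact ⟨b, ⟨ht.1.trans h3.le, h2⟩, h3⟩

theorem uniqueDiffOn_timeInterval {T : EReal} (hT : 0 < T) : UniqueDiffOn ℝ (timeInterval T) := by
  obtain ⟨b, hb, hb0⟩ := exists_gt_mem_timeInterval (zero_mem_timeInterval hT)
  refine uniqueDiffOn_convex ?_ ⟨b / 2, ?_⟩
  · refine Set.OrdConnected.convex ⟨fun x hx y hy z hz => ?_⟩
    exact Icc_subset_timeInterval hy ⟨hx.1.trans hz.1, hz.2⟩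
  · refine mem_interior_iff_mem_nhds.2 (mem_of_superset
      (Icc_mem_nhds (by linarith : (0 : ℝ) < b / 2) (by linarith : b / 2 < b))
      (Icc_subset_timeInterval hb))

theorem integral_eq_sub_of_hasDerivWithinAt_timeInterval {T : EReal} {φ φ' : ℝ → ℝ}
    (h : ∀ s ∈ timeInterval T, HasDerivWithinAt φ (φ' s) (timeInterval T) s)
    (hc : ContinuousOn φ' (timeInterval T)) {t : ℝ} (ht : t ∈ timeInterval T) :
    ∫ s in (0 : ℝ)..t, φ' s = φ t - φ 0 := by
  have hs := Icc_subset_timeInterval ht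
  refine intervalIntegral.integral_eq_sub_of_hasDerivAt_of_le ht.1
    (fun s hs' => (h s (hs hs')).continuousWithinAt.mono hs) (fun s hs' => ?_)
    (ContinuousOn.intervalIntegrable_of_Icc ht.1 (hc.mono hs))
  exact (h s (hs ⟨hs'.1.le, hs'.2.le⟩)).hasDerivAt
    (mem_of_superset (Icc_mem_nhds hs'.1 hs'.2) hs)

theorem hasDerivWithinAt_of_eq_integral {T : EReal} {F G : ℝ → ℝ}
    (hG : ContinuousOn G (timeInterval T))
    (h : ∀ t ∈ timeInterval T, F t = F 0 + ∫ s in (0 : ℝ)..t, G s) {t : ℝ}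
    (ht : t ∈ timeInterval T) : HasDerivWithinAt F (G t) (timeInterval T) t := by
  obtain ⟨b, hb, htb⟩ := exists_gt_mem_timeInterval ht
  have hb0 : 0 ≤ b := hb.1
  have hGb : ContinuousOn G (Set.Icc 0 b) := hG.mono (Icc_subset_timeInterval hb)
  -- Extending `G` by constants outside `[0, b]`, with `b > t`, gives a continuous function on the
  -- line. The usual fundamental theorem then also covers the endpoint `t = 0`.
  have hcont : Continuous (Set.IccExtend hb0 ((Set.Icc 0 b).domRestrict G)) :=
    (continuousOn_iff_continuous_domRestrict.1 hGb).Icc_extend'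
  have heq : ∀ s ∈ Set.Icc 0 b, Set.IccExtend hb0 ((Set.Icc 0 b).domRestrict G) s = G s := fun s hs => by
    rw [Set.IccExtend_of_mem _ _ hs]; rfl
  have h1 := ((hcont.integral_hasStrictDerivAt 0 t).hasDerivAt.const_add (F 0)).hasDerivWithinAt
    (s := timeInterval T)
  rw [heq t ⟨ht.1, htb.le⟩] at h1
  have h2 : ∀ s ∈ Set.Icc 0 b,
      F s = F 0 + ∫ r in (0 : ℝ)..s, Set.IccExtend hb0 ((Set.Icc 0 b).domRestrict G) r := by
    intro s hs
    rw [h s (Icc_subset_timeInterval hb hs)]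
    congr 1
    refine intervalIntegral.integral_congr fun r hr => (heq r ?_).symm
    rw [Set.uIcc_of_le hs.1] at hr
    exact ⟨hr.1, hr.2.trans hs.2⟩
  refine h1.congr_of_eventuallyEq ?_ (h2 t ⟨ht.1, htb.le⟩)
  filter_upwards [self_mem_nhdsWithin, mem_nhdsWithin_of_mem_nhds (gt_mem_nhds htb)] with s hs hsb
  exact h2 s ⟨hs.1, le_of_lt hsb⟩

end TimeInterval

/-! ### The equation tested with dilations and with weights. -/

theorem H1.continuous_norm_dx : Continuous fun v : H1 => ‖v.dx‖ :=
  ((WithLp.sndL 2 ℂ L2 L2).continuous.comp continuous_subtype_val).norm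

theorem energyCorrelation_eq (γ : ℝ) {p : ℝ} (u v : H1) {c : ℝ}
    (hv : ∀ x, v x = (starRingEnd ℂ) (u (c * x)))
    (hdv : v.dx =ᵐ[volume] fun x => c * (starRingEnd ℂ) (u.dx (c * x))) :
    ((∫ x, u.dx x * v.dx x) - (γ : ℂ) * (u 0 * v 0)
        - ∫ x, ((‖u x‖ ^ (p - 1) : ℝ) : ℂ) * u x * v x).re = energyCorrelation γ p u c := by
  have h1 : ∫ x, u.dx x * v.dx x
      = (c : ℂ) * (starRingEnd ℂ) (∫ x, u.dx (c * x) * (starRingEnd ℂ) (u.dx x)) := by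
    rw [← integral_conj, ← integral_const_mul]
    refine integral_congr_ae ?_
    filter_upwards [hdv] with x hx
    rw [hx, map_mul, Complex.conj_conj]
    ring
  have h2 : ∫ x, ((‖u x‖ ^ (p - 1) : ℝ) : ℂ) * u x * v x
      = (starRingEnd ℂ) (∫ x, u (c * x) * (starRingEnd ℂ) (nonlin p u x)) := by
    rw [← integral_conj]
    refine integral_congr_ae (Eventually.of_forall fun x => ?_)
    simp only [hv, nonlin, map_mul, Complex.conj_conj]
    ring
  have h3 : u 0 * v 0 = ((‖u 0‖ ^ 2 : ℝ) : ℂ) := by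
    rw [hv, mul_zero, Complex.mul_conj']
    push_cast
    rfl
  rw [h1, h2, h3, Complex.sub_re, Complex.sub_re, Complex.re_ofReal_mul, Complex.re_ofReal_mul,
    Complex.conj_re, Complex.conj_re, Complex.ofReal_re]
  rfl

namespace IsSolution

variable {γ p : ℝ} {u₀ : H1} {T : EReal} {u : ℝ → H1}

/-- By the equation this quantity is the real part of `i∂ₜu` paired with the dilated conjugate, and
both factors are continuous in time. -/
theorem continuousOn_energyCorrelation (hT : 0 < T) (hu : IsSolution γ p u₀ T u) {c : ℝ}
    (hc : 0 < c) : ContinuousOn (fun t => energyCorrelation γ p (u t) c) (timeInterval T) := by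
  obtain ⟨K, hK, hK1, hK2⟩ := H1.exists_dilation_conj hc
  have h1 := continuousOn_derivWithin_apply (uniqueDiffOn_timeInterval hT) hu.contDiffOn
    (hK.comp_continuousOn hu.continuousOn)
  refine (Complex.continuous_re.comp_continuousOn (h1.const_smul Complex.I)).congr fun t ht => ?_
  have h2 := congrArg Complex.re (hu.eq t ht (K (u t)))
  rw [energyCorrelation_eq γ (u t) _ (hK1 (u t)) (hK2 (u t))] at h2
  exact h2.symm

theorem hasDerivWithinAt_im_dilation (hu : IsSolution γ p u₀ T u) {c : ℝ}
    (hc : 0 < c) {t : ℝ} (ht : t ∈ timeInterval T) :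
    HasDerivWithinAt (fun s => (∫ x, u s (c * x) * (starRingEnd ℂ) (u s x)).im)
      (energyCorrelation γ p (u t) c - c⁻¹ * energyCorrelation γ p (u t) c⁻¹)
      (timeInterval T) t := by
  obtain ⟨K, hK, hK1, hK2⟩ := H1.exists_dilation_conj hc
  obtain ⟨K', -, hK1', hK2'⟩ := H1.exists_dilation_conj (inv_pos.2 hc)
  -- Change of variables: dilation by `c` has adjoint `c⁻¹` times dilation by `c⁻¹`, the source of
  -- the term `c⁻¹ * energyCorrelation γ p (u t) c⁻¹`.
  have hadj : ∀ v w : H1, v.toHneg1 (K w)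
      = (starRingEnd ℂ) (w.toHneg1 (((c⁻¹ : ℝ) : ℂ) • K' v)) := by
    intro v w
    rw [map_smul, H1.toHneg1_apply, H1.toHneg1_apply, smul_eq_mul, map_mul, Complex.conj_ofReal,
      ← integral_conj]
    simp only [hK1, hK1', map_mul, Complex.conj_conj]
    have := Measure.integral_comp_mul_left
      (fun y => v (c⁻¹ * y) * (starRingEnd ℂ) (w y)) c
    simp only [inv_mul_cancel_left₀ hc.ne', abs_of_pos (inv_pos.2 hc), Complex.real_smul] at this
    rw [this]
    congr 2
    ext x
    ring
  have h1 := hasDerivWithinAt_pairing (fun v : H1 => v.toHneg1) hu.continuousOn hu.contDiffOn hK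
    hadj ht
  have h2 := (Complex.imCLM.hasFDerivAt.comp_hasDerivWithinAt t h1).neg
  have e1 := congrArg Complex.re (hu.eq t ht (K (u t)))
  have e2 := congrArg Complex.re (hu.eq t ht (K' (u t)))
  rw [energyCorrelation_eq γ (u t) _ (hK1 (u t)) (hK2 (u t)), Complex.I_mul_re] at e1
  rw [energyCorrelation_eq γ (u t) _ (hK1' (u t)) (hK2' (u t)), Complex.I_mul_re] at e2
  have e3 : -Complex.imCLM (derivWithin (fun s => (u s).toHneg1) (timeInterval T) t (K (u t))
        + (starRingEnd ℂ) (derivWithin (fun s => (u s).toHneg1) (timeInterval T) t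
          (((c⁻¹ : ℝ) : ℂ) • K' (u t))))
      = energyCorrelation γ p (u t) c - c⁻¹ * energyCorrelation γ p (u t) c⁻¹ := by
    rw [map_smul, smul_eq_mul, Complex.imCLM_apply, Complex.add_im, Complex.conj_im,
      Complex.im_ofReal_mul, ← e1, ← e2]
    ring
  rw [e3] at h2
  refine h2.congr_of_mem (fun s _ => ?_) ht
  simp only [Pi.neg_apply, Function.comp_apply, Complex.imCLM_apply]
  rw [H1.toHneg1_apply, ← Complex.conj_im, ← integral_conj]
  simp only [hK1, map_mul, Complex.conj_conj]
  congr 2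
  ext x
  ring

theorem hasDerivWithinAt_weighted (hu : IsSolution γ p u₀ T u) (hT : 0 < T) {θ : ℝ → ℝ}
    (hθ : ContDiff ℝ ∞ θ) {A B : ℝ} (hA : ∀ x, |θ x| ≤ A) (hB : ∀ x, |deriv θ x| ≤ B) :
    (∀ t ∈ timeInterval T, HasDerivWithinAt (fun s => ∫ x, θ x * ‖u s x‖ ^ 2)
      (2 * (∫ x, ((deriv θ x : ℝ) : ℂ) * (starRingEnd ℂ) (u t x) * (u t).dx x).im)
      (timeInterval T) t) ∧
    ContinuousOn (fun t =>
      2 * (∫ x, ((deriv θ x : ℝ) : ℂ) * (starRingEnd ℂ) (u t x) * (u t).dx x).im)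
      (timeInterval T) := by
  obtain ⟨K, hK, hK1, hK2⟩ := H1.exists_mul_conj hθ hA hB
  have hadj : ∀ v w : H1, v.toHneg1 (K w) = (starRingEnd ℂ) (w.toHneg1 (K v)) := by
    intro v w
    rw [H1.toHneg1_apply, H1.toHneg1_apply, ← integral_conj]
    simp only [hK1, map_mul, Complex.conj_conj, Complex.conj_ofReal]
    congr 1
    ext x
    ring
  -- With test function `θū` the Dirac and nonlinear terms and `θ|∂ₓu|²` are real. Only the term
  -- where the derivative falls on `θ` has an imaginary part.
  have key : ∀ t ∈ timeInterval T,
      (derivWithin (fun s => (u s).toHneg1) (timeInterval T) t (K (u t))).re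
        = (∫ x, ((deriv θ x : ℝ) : ℂ) * (starRingEnd ℂ) (u t x) * (u t).dx x).im := by
    intro t ht
    have e1 := congrArg Complex.im (hu.eq t ht (K (u t)))
    rw [Complex.I_mul_im] at e1
    rw [e1]
    have m1 := memLp_bdd_mul (memLp_star (u t).memLp_rep) (hθ.continuous_deriv (by simp)) hB
    have m2 := memLp_bdd_mul (memLp_star (u t).memLp_dx) hθ.continuous hA
    have s1 : ∫ x, (u t).dx x * (K (u t)).dx x
        = (∫ x, ((deriv θ x : ℝ) : ℂ) * (starRingEnd ℂ) (u t x) * (u t).dx x)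
          + ∫ x, ((θ x * ‖(u t).dx x‖ ^ 2 : ℝ) : ℂ) := by
      have : ∀ x, ((θ x * ‖(u t).dx x‖ ^ 2 : ℝ) : ℂ)
          = (θ x : ℂ) * (starRingEnd ℂ) ((u t).dx x) * (u t).dx x := fun x => by
        rw [mul_assoc, Complex.conj_mul']
        push_cast
        rfl
      simp only [this]
      rw [← integral_add (integrable_mul_of_memLp m1 (u t).memLp_dx)
        (integrable_mul_of_memLp m2 (u t).memLp_dx)]
      refine integral_congr_ae ?_
      filter_upwards [hK2 (u t)] with x hx
      rw [hx]
      ring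
    have s2 : (γ : ℂ) * (u t 0 * K (u t) 0) = ((γ * (θ 0 * ‖u t 0‖ ^ 2) : ℝ) : ℂ) := by
      rw [hK1, mul_left_comm (u t 0), Complex.mul_conj']
      push_cast
      rfl
    have s3 : ∫ x, ((‖u t x‖ ^ (p - 1) : ℝ) : ℂ) * u t x * K (u t) x
        = ∫ x, ((‖u t x‖ ^ (p - 1) * (θ x * ‖u t x‖ ^ 2) : ℝ) : ℂ) := by
      congr 1
      ext x
      rw [hK1, mul_assoc, mul_left_comm (u t x), Complex.mul_conj']
      push_cast
      rfl
    rw [s1, s2, s3, integral_complex_ofReal, integral_complex_ofReal]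
    simp only [Complex.sub_im, Complex.add_im, Complex.ofReal_im, add_zero, sub_zero]
  constructor
  · intro t ht
    have h1 := hasDerivWithinAt_pairing (fun v : H1 => v.toHneg1) hu.continuousOn hu.contDiffOn hK
      hadj ht
    have h2 := Complex.reCLM.hasFDerivAt.comp_hasDerivWithinAt t h1
    rw [Complex.reCLM_apply, Complex.add_re, Complex.conj_re, key t ht, ← two_mul] at h2
    refine h2.congr_of_mem (fun s _ => ?_) ht
    simp only [Function.comp_apply, Complex.reCLM_apply]
    rw [H1.toHneg1_apply]
    have : ∀ x, u s x * K (u s) x = ((θ x * ‖u s x‖ ^ 2 : ℝ) : ℂ) := fun x => by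
      rw [hK1, mul_left_comm, Complex.mul_conj']
      push_cast
      rfl
    simp only [this]
    rw [integral_complex_ofReal, Complex.ofReal_re]
  · have h1 := continuousOn_derivWithin_apply (uniqueDiffOn_timeInterval hT) hu.contDiffOn
      (hK.comp_continuousOn hu.continuousOn)
    refine ((Complex.continuous_re.comp_continuousOn h1).const_smul (2 : ℝ)).congr fun t ht => ?_
    simp only [Function.comp_apply]
    rw [← key t ht]
    rfl

theorem exists_norm_le (hu : IsSolution γ p u₀ T u) {t : ℝ} (ht : t ∈ timeInterval T) :
    ∃ m, ∀ s ∈ Set.Icc 0 t, ‖u s‖ ≤ m :=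
  isCompact_Icc.exists_bound_of_continuousOn (hu.continuousOn.mono (Icc_subset_timeInterval ht))

/-- Continuity of the `L^(p+1)` term is read off from the equation: at `c = 1` the energy
correlation is `‖∂ₓu‖² - γ|u(0)|² - ‖u‖_{p+1}^{p+1}`, and all its other terms are already continuous
in time. -/
theorem continuousOn_Q (hT : 0 < T) (hp : 1 < p) (hu : IsSolution γ p u₀ T u) :
    ContinuousOn (fun t => Q γ p (u t)) (timeInterval T) := by
  have h1 := hu.continuousOn_energyCorrelation hT one_pos
  have h2 : ContinuousOn (fun t => ‖(u t).dx‖) (timeInterval T) :=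
    H1.continuous_norm_dx.comp_continuousOn hu.continuousOn
  have h3 : ContinuousOn (fun t => ‖u t 0‖) (timeInterval T) :=
    ((H1.continuous_apply 0).comp_continuousOn hu.continuousOn).norm
  have h4 : ∀ t, potential p (u t)
      = ‖(u t).dx‖ ^ 2 - γ * ‖u t 0‖ ^ 2 - energyCorrelation γ p (u t) 1 := fun t => by
    rw [energyCorrelation, potentialCorrelation_one hp, kineticCorrelation_one]
    ring
  have h5 : ContinuousOn (fun t => ‖(u t).dx‖ ^ 2 - γ / 2 * ‖u t 0‖ ^ 2 - (p - 1) / (2 * (p + 1)) *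
      (‖(u t).dx‖ ^ 2 - γ * ‖u t 0‖ ^ 2 - energyCorrelation γ p (u t) 1)) (timeInterval T) :=
    ((h2.pow 2).sub ((h3.pow 2).const_mul _)).sub
      ((((h2.pow 2).sub ((h3.pow 2).const_mul _)).sub h1).const_mul _)
  refine h5.congr fun t _ => ?_
  simp only [← h4]
  rfl

end IsSolution

/-! ### The truncated weight and the limit `ε → 0`. -/

/-- A smooth bounded approximation of the weight `x²`. -/
def cutoff (ε x : ℝ) : ℝ := x ^ 2 / (1 + ε * x ^ 2)

section Cutoff

variable {ε : ℝ}

theorem one_add_mul_sq_pos (hε : 0 ≤ ε) (x : ℝ) : 0 < 1 + ε * x ^ 2 := by positivity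

theorem cutoff_nonneg (hε : 0 ≤ ε) (x : ℝ) : 0 ≤ cutoff ε x :=
  div_nonneg (sq_nonneg x) (one_add_mul_sq_pos hε x).le

theorem contDiff_cutoff (hε : 0 ≤ ε) : ContDiff ℝ ∞ (cutoff ε) := by
  unfold cutoff
  exact ContDiff.div (by fun_prop) (by fun_prop) fun x => (one_add_mul_sq_pos hε x).ne'

theorem cutoff_le_sq (hε : 0 ≤ ε) (x : ℝ) : cutoff ε x ≤ x ^ 2 :=
  div_le_self (sq_nonneg x) (by nlinarith [mul_nonneg hε (sq_nonneg x)])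

theorem abs_cutoff_le (hε : 0 < ε) (x : ℝ) : |cutoff ε x| ≤ 1 / ε := by
  rw [abs_of_nonneg (cutoff_nonneg hε.le x), cutoff, div_le_div_iff₀ (by positivity) hε]
  linarith

theorem deriv_cutoff (hε : 0 ≤ ε) (x : ℝ) : deriv (cutoff ε) x = 2 * x / (1 + ε * x ^ 2) ^ 2 := by
  have h0 := (one_add_mul_sq_pos hε x).ne'
  have h1 : HasDerivAt (fun x : ℝ => x ^ 2) (2 * x) x := by simpa using hasDerivAt_pow 2 x
  have h2 := h1.div ((h1.const_mul ε).const_add 1) h0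
  refine h2.deriv.trans ?_
  congr 1
  ring

/-- The truncated form of `(2x)² = 4x²`. Its constant is independent of `ε`, so the Grönwall
argument closes uniformly. -/
theorem deriv_cutoff_sq_le (hε : 0 ≤ ε) (x : ℝ) : deriv (cutoff ε) x ^ 2 ≤ 4 * cutoff ε x := by
  have h0 := one_add_mul_sq_pos hε x
  have h1 : 1 ≤ 1 + ε * x ^ 2 := by nlinarith [mul_nonneg hε (sq_nonneg x)]
  rw [deriv_cutoff hε, cutoff, div_pow, ← mul_div_assoc, mul_pow]
  norm_num
  rw [← pow_mul]
  gcongr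
  exact le_self_pow₀ h1 (by norm_num)

theorem abs_deriv_cutoff_le (hε : 0 ≤ ε) (x : ℝ) : |deriv (cutoff ε) x| ≤ 2 * |x| := by
  refine abs_le_of_sq_le_sq ?_ (by positivity)
  rw [mul_pow, sq_abs]
  nlinarith [deriv_cutoff_sq_le hε x, cutoff_le_sq hε x]

theorem abs_deriv_cutoff_le_const (hε : 0 < ε) (x : ℝ) :
    |deriv (cutoff ε) x| ≤ 2 * √(1 / ε) := by
  have h1 := deriv_cutoff_sq_le hε.le x
  have h2 := (le_abs_self _).trans (abs_cutoff_le hε x)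
  refine abs_le_of_sq_le_sq ?_ (by positivity)
  rw [mul_pow, Real.sq_sqrt (by positivity)]
  linarith

theorem tendsto_cutoff (x : ℝ) {e : ℕ → ℝ} (he : Tendsto e atTop (𝓝 0)) :
    Tendsto (fun n => cutoff (e n) x) atTop (𝓝 (x ^ 2)) := by
  have h : Tendsto (fun n => x ^ 2 / (1 + e n * x ^ 2)) atTop (𝓝 (x ^ 2 / (1 + 0 * x ^ 2))) :=
    tendsto_const_nhds.div ((he.mul_const _).const_add 1) (by simp)
  simpa [cutoff] using h

theorem tendsto_deriv_cutoff (x : ℝ) {e : ℕ → ℝ} (he0 : ∀ n, 0 ≤ e n)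
    (he : Tendsto e atTop (𝓝 0)) :
    Tendsto (fun n => deriv (cutoff (e n)) x) atTop (𝓝 (2 * x)) := by
  simp only [deriv_cutoff (he0 _)]
  have h : Tendsto (fun n => 2 * x / (1 + e n * x ^ 2) ^ 2) atTop
      (𝓝 (2 * x / (1 + 0 * x ^ 2) ^ 2)) :=
    tendsto_const_nhds.div (((he.mul_const _).const_add 1).pow 2) (by simp)
  simpa using h

end Cutoff

theorem continuous_cutoff {ε : ℝ} (hε : 0 ≤ ε) : Continuous (cutoff ε) :=
  (contDiff_cutoff hε).continuous

theorem integrable_cutoff {ε : ℝ} (hε : 0 < ε) (v : H1) :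
    Integrable fun x => cutoff ε x * ‖v x‖ ^ 2 :=
  (v.memLp_rep.integrable_norm_pow (by norm_num)).bdd_mul
    (continuous_cutoff hε.le).aestronglyMeasurable
    (Eventually.of_forall fun x => by rw [Real.norm_eq_abs]; exact abs_cutoff_le hε x)

theorem norm_weighted_sq (v : H1) (x : ℝ) : ‖(x : ℂ) * v x‖ ^ 2 = x ^ 2 * ‖v x‖ ^ 2 := by
  rw [norm_mul, Complex.norm_real, mul_pow, Real.norm_eq_abs, sq_abs]

theorem integrable_weighted_sq {v : H1} (h : MemLp (fun x : ℝ => (x : ℂ) * v x) 2 volume) :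
    Integrable fun x => x ^ 2 * ‖v x‖ ^ 2 := by
  have := h.integrable_norm_pow (by norm_num)
  simpa only [ENNReal.toReal_ofNat, norm_weighted_sq] using this

theorem variance_eq (v : H1) : variance v = ∫ x, x ^ 2 * ‖v x‖ ^ 2 := by
  simp only [variance, norm_weighted_sq]

theorem tendsto_integral_cutoff {v : H1} (h : MemLp (fun x : ℝ => (x : ℂ) * v x) 2 volume)
    {e : ℕ → ℝ} (he0 : ∀ n, 0 < e n) (he : Tendsto e atTop (𝓝 0)) :
    Tendsto (fun n => ∫ x, cutoff (e n) x * ‖v x‖ ^ 2) atTop (𝓝 (variance v)) := by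
  rw [variance_eq]
  refine tendsto_integral_of_dominated_convergence (fun x => x ^ 2 * ‖v x‖ ^ 2)
    (fun n => (integrable_cutoff (he0 n) v).aestronglyMeasurable) (integrable_weighted_sq h)
    (fun n => Eventually.of_forall fun x => ?_) (Eventually.of_forall fun x => ?_)
  · have := cutoff_nonneg (he0 n).le x
    rw [Real.norm_of_nonneg (by positivity)]
    gcongr
    exact cutoff_le_sq (he0 n).le x
  · exact (tendsto_cutoff x he).mul_const _

theorem integral_cutoff_le_variance {v : H1}
    (h : MemLp (fun x : ℝ => (x : ℂ) * v x) 2 volume) {ε : ℝ} (hε : 0 < ε) :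
    ∫ x, cutoff ε x * ‖v x‖ ^ 2 ≤ variance v := by
  rw [variance_eq]
  refine integral_mono (integrable_cutoff hε v) (integrable_weighted_sq h) fun x => ?_
  simp only
  gcongr
  exact cutoff_le_sq hε.le x

/-- Fatou's lemma along `e n → 0`. -/
theorem memLp_weighted_of_bound {v : H1} {C : ℝ} {e : ℕ → ℝ} (he0 : ∀ n, 0 < e n)
    (he : Tendsto e atTop (𝓝 0)) (hC : ∀ n, ∫ x, cutoff (e n) x * ‖v x‖ ^ 2 ≤ C) :
    MemLp (fun x : ℝ => (x : ℂ) * v x) 2 volume := by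
  have hvc := v.continuous_rep
  have hm : AEStronglyMeasurable (fun x : ℝ => (x : ℂ) * v x) volume := by fun_prop
  refine (memLp_two_iff_integrable_sq_norm hm).2 ⟨(hm.norm.pow 2), ?_⟩
  simp only [norm_weighted_sq]
  rw [hasFiniteIntegral_iff_ofReal (Eventually.of_forall fun x => by positivity)]
  have h1 : ∀ x, ENNReal.ofReal (x ^ 2 * ‖v x‖ ^ 2)
      = liminf (fun n => ENNReal.ofReal (cutoff (e n) x * ‖v x‖ ^ 2)) atTop := fun x =>
    ((ENNReal.continuous_ofReal.tendsto _).comp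
      ((tendsto_cutoff x he).mul_const (‖v x‖ ^ 2))).liminf_eq.symm
  simp only [h1]
  refine lt_of_le_of_lt (lintegral_liminf_le fun n => ?_)
    (lt_of_le_of_lt ?_ (ENNReal.ofReal_lt_top (r := C)))
  · have := continuous_cutoff (he0 n).le
    exact (ENNReal.continuous_ofReal.comp (by fun_prop)).measurable
  · refine liminf_le_of_le ?_ fun b hb => ?_
    · isBoundedDefault
    · obtain ⟨n, hn⟩ := hb.exists
      refine hn.trans ?_
      rw [← ofReal_integral_eq_lintegral_ofReal (integrable_cutoff (he0 n) v)
        (Eventually.of_forall fun x => mul_nonneg (cutoff_nonneg (he0 n).le x) (by positivity))]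
      exact ENNReal.ofReal_le_ofReal (hC n)

theorem memLp_deriv_cutoff {ε : ℝ} (hε : 0 < ε) (v : H1) :
    MemLp (fun x => ((deriv (cutoff ε) x : ℝ) : ℂ) * (starRingEnd ℂ) (v x)) 2 volume :=
  memLp_bdd_mul (memLp_star v.memLp_rep) ((contDiff_cutoff hε.le).continuous_deriv (by simp))
    (abs_deriv_cutoff_le_const hε)

theorem abs_flux_le {ε : ℝ} (hε : 0 < ε) (v : H1) :
    |2 * (∫ x, ((deriv (cutoff ε) x : ℝ) : ℂ) * (starRingEnd ℂ) (v x) * v.dx x).im|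
      ≤ 2 * (∫ x, cutoff ε x * ‖v x‖ ^ 2) + 2 * ‖v‖ ^ 2 := by
  have hm := memLp_deriv_cutoff hε v
  set a := l2 (fun x => ((deriv (cutoff ε) x : ℝ) : ℂ) * (starRingEnd ℂ) (v x)) with ha
  have h1 : a ^ 2 ≤ 4 * ∫ x, cutoff ε x * ‖v x‖ ^ 2 := by
    rw [ha, l2_sq hm, ← integral_const_mul]
    refine integral_mono (hm.integrable_norm_pow (by norm_num))
      ((integrable_cutoff hε v).const_mul 4) fun x => ?_
    simp only [norm_mul, Complex.norm_real, RCLike.norm_conj, mul_pow, Real.norm_eq_abs, sq_abs]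
    rw [← mul_assoc]
    gcongr
    exact deriv_cutoff_sq_le hε.le x
  have h2 := (Complex.abs_im_le_norm _).trans (norm_integral_mul_le hm v.memLp_dx)
  rw [← ha] at h2
  have h3 := v.l2_dx_le
  have h4 : a * l2 v.dx ≤ a * ‖v‖ := by
    have : 0 ≤ a := l2_nonneg _
    gcongr
  rw [abs_mul, abs_two]
  -- The square gives `2a‖v‖ ≤ a²/2 + 2‖v‖²`, and `h1` bounds `a²/2` by twice the truncated
  -- variance.
  nlinarith [sq_nonneg (a - 2 * ‖v‖)]

theorem abs_flux_le_of_memLp {ε : ℝ} (hε : 0 < ε) {v : H1}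
    (h : MemLp (fun x : ℝ => (x : ℂ) * v x) 2 volume) :
    |2 * (∫ x, ((deriv (cutoff ε) x : ℝ) : ℂ) * (starRingEnd ℂ) (v x) * v.dx x).im|
      ≤ 2 * variance v + 2 * ‖v‖ ^ 2 := by
  linarith [abs_flux_le hε v, integral_cutoff_le_variance h hε]

theorem tendsto_flux {v : H1} (h : MemLp (fun x : ℝ => (x : ℂ) * v x) 2 volume)
    {e : ℕ → ℝ} (he0 : ∀ n, 0 < e n) (he : Tendsto e atTop (𝓝 0)) :
    Tendsto (fun n =>
      2 * (∫ x, ((deriv (cutoff (e n)) x : ℝ) : ℂ) * (starRingEnd ℂ) (v x) * v.dx x).im) atTop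
      (𝓝 (4 * weightedMomentum v)) := by
  have hi := integrable_weightedMomentum v h
  have h1 : Tendsto (fun n =>
      ∫ x, ((deriv (cutoff (e n)) x : ℝ) : ℂ) * (starRingEnd ℂ) (v x) * v.dx x) atTop
      (𝓝 (∫ x : ℝ, 2 * ((starRingEnd ℂ) (v x) * (x : ℂ) * v.dx x))) := by
    refine tendsto_integral_of_dominated_convergence
      (fun x : ℝ => 2 * ‖(starRingEnd ℂ) (v x) * (x : ℂ) * v.dx x‖)
      (fun n => (integrable_mul_of_memLp (memLp_deriv_cutoff (he0 n) v)
        v.memLp_dx).aestronglyMeasurable) (hi.norm.const_mul 2)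
      (fun n => Eventually.of_forall fun x => ?_) (Eventually.of_forall fun x => ?_)
    · have := abs_deriv_cutoff_le (he0 n).le x
      simp only [norm_mul, Complex.norm_real, RCLike.norm_conj, Real.norm_eq_abs]
      calc |deriv (cutoff (e n)) x| * ‖v x‖ * ‖v.dx x‖ ≤ 2 * |x| * ‖v x‖ * ‖v.dx x‖ := by gcongr
        _ = 2 * (‖v x‖ * |x| * ‖v.dx x‖) := by ring
    · have h2 := (((Complex.continuous_ofReal.tendsto _).comp
        (tendsto_deriv_cutoff x (fun n => (he0 n).le) he)).mul_const
          ((starRingEnd ℂ) (v x))).mul_const (v.dx x)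
      have h3 : ((2 * x : ℝ) : ℂ) * (starRingEnd ℂ) (v x) * v.dx x
          = 2 * ((starRingEnd ℂ) (v x) * (x : ℂ) * v.dx x) := by
        push_cast
        ring
      rw [h3] at h2
      exact h2
  have h2 := ((Complex.continuous_im.tendsto _).comp h1).const_mul 2
  have h3 : 2 * (∫ x : ℝ, 2 * ((starRingEnd ℂ) (v x) * (x : ℂ) * v.dx x)).im
      = 4 * weightedMomentum v := by
    rw [integral_const_mul, weightedMomentum, Complex.mul_im]
    norm_num
    ring
  rw [h3] at h2
  exact h2

/-! ### Integral identities for the variance and the momentum, and their derivatives. -/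

namespace IsSolution

variable {γ p : ℝ} {u₀ : H1} {T : EReal} {u : ℝ → H1}

theorem hasDerivWithinAt_cutoff (hu : IsSolution γ p u₀ T u) (hT : 0 < T) {ε : ℝ} (hε : 0 < ε) :
    (∀ t ∈ timeInterval T, HasDerivWithinAt (fun s => ∫ x, cutoff ε x * ‖u s x‖ ^ 2)
      (2 * (∫ x, ((deriv (cutoff ε) x : ℝ) : ℂ) * (starRingEnd ℂ) (u t x) * (u t).dx x).im)
      (timeInterval T) t) ∧
    ContinuousOn (fun t =>
      2 * (∫ x, ((deriv (cutoff ε) x : ℝ) : ℂ) * (starRingEnd ℂ) (u t x) * (u t).dx x).im)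
      (timeInterval T) :=
  hu.hasDerivWithinAt_weighted hT (contDiff_cutoff hε.le) (abs_cutoff_le hε)
    (abs_deriv_cutoff_le_const hε)

theorem integral_cutoff_le (hu : IsSolution γ p u₀ T u) (hT : 0 < T)
    (hxu₀ : MemLp (fun x : ℝ => (x : ℂ) * u₀ x) 2 volume) {t : ℝ} (ht : t ∈ timeInterval T)
    {m : ℝ} (hm : ∀ s ∈ Set.Icc 0 t, ‖u s‖ ≤ m) {ε : ℝ} (hε : 0 < ε) :
    ∀ s ∈ Set.Icc 0 t, ∫ x, cutoff ε x * ‖u s x‖ ^ 2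
      ≤ gronwallBound (variance u₀) 2 (2 * m ^ 2) (s - 0) := by
  obtain ⟨hd, -⟩ := hu.hasDerivWithinAt_cutoff hT hε
  have hsub := Icc_subset_timeInterval ht
  have hnn : ∀ s, 0 ≤ ∫ x, cutoff ε x * ‖u s x‖ ^ 2 := fun s =>
    integral_nonneg fun x => mul_nonneg (cutoff_nonneg hε.le x) (by positivity)
  intro s hs
  refine (Real.le_norm_self _).trans (norm_le_gronwallBound_of_norm_deriv_right_le
    (f := fun s => ∫ x, cutoff ε x * ‖u s x‖ ^ 2)
    (f' := fun s => 2 * (∫ x, ((deriv (cutoff ε) x : ℝ) : ℂ) * (starRingEnd ℂ) (u s x)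
      * (u s).dx x).im)
    (fun r hr => (hd r (hsub hr)).continuousWithinAt.mono hsub) (fun r hr => ?_) ?_
    (fun r hr => ?_) s hs)
  -- Grönwall asks for the right derivative, and `[0, T)` contains a right neighbourhood of `r`.
  · refine (hd r (hsub ⟨hr.1, hr.2.le⟩)).mono_of_mem_nhdsWithin ?_
    refine mem_of_superset (Icc_mem_nhdsGE hr.2) fun q hq => hsub ⟨hr.1.trans hq.1, hq.2⟩
  · rw [Real.norm_of_nonneg (hnn 0), hu.initial]
    exact integral_cutoff_le_variance hxu₀ hε
  · rw [Real.norm_eq_abs, Real.norm_of_nonneg (hnn r)]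
    have h1 := abs_flux_le hε (u r)
    have h2 := hm r ⟨hr.1, hr.2.le⟩
    have h3 : ‖u r‖ ^ 2 ≤ m ^ 2 := by gcongr
    linarith

theorem exists_variance_le (hu : IsSolution γ p u₀ T u) (hT : 0 < T)
    (hxu₀ : MemLp (fun x : ℝ => (x : ℂ) * u₀ x) 2 volume) {t : ℝ} (ht : t ∈ timeInterval T) :
    ∃ C, ∀ s ∈ Set.Icc 0 t,
      MemLp (fun x : ℝ => (x : ℂ) * u s x) 2 volume ∧ variance (u s) ≤ C := by
  obtain ⟨m, hm⟩ := hu.exists_norm_le ht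
  have hv0 : 0 ≤ variance u₀ := integral_nonneg fun x => by positivity
  have he0 : ∀ n : ℕ, (0 : ℝ) < 1 / ((n : ℝ) + 1) := fun n => by positivity
  have he := tendsto_one_div_add_atTop_nhds_zero_nat (𝕜 := ℝ)
  refine ⟨gronwallBound (variance u₀) 2 (2 * m ^ 2) (t - 0), fun s hs => ?_⟩
  have hb : ∀ n : ℕ, ∫ x, cutoff (1 / ((n : ℝ) + 1)) x * ‖u s x‖ ^ 2
      ≤ gronwallBound (variance u₀) 2 (2 * m ^ 2) (t - 0) := fun n =>
    (hu.integral_cutoff_le hT hxu₀ ht hm (he0 n) s hs).trans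
      (gronwallBound_mono hv0 (by positivity) (by norm_num) (by linarith [hs.2]))
  have hmem := memLp_weighted_of_bound he0 he hb
  exact ⟨hmem, le_of_tendsto (tendsto_integral_cutoff hmem he0 he) (Eventually.of_forall hb)⟩

theorem memLp_weighted (hu : IsSolution γ p u₀ T u) (hT : 0 < T)
    (hxu₀ : MemLp (fun x : ℝ => (x : ℂ) * u₀ x) 2 volume) {t : ℝ} (ht : t ∈ timeInterval T) :
    MemLp (fun x : ℝ => (x : ℂ) * u t x) 2 volume := by
  obtain ⟨C, hC⟩ := hu.exists_variance_le hT hxu₀ ht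
  exact (hC t ⟨ht.1, le_rfl⟩).1

/-- The truncated identity integrated in time, with `ε → 0`. The bounds on `‖u s‖` and on the
variance over `[0, t]` give a constant dominating the flux. -/
theorem variance_eq_integral (hu : IsSolution γ p u₀ T u) (hT : 0 < T)
    (hxu₀ : MemLp (fun x : ℝ => (x : ℂ) * u₀ x) 2 volume) {t : ℝ} (ht : t ∈ timeInterval T) :
    variance (u t) = variance (u 0) + ∫ s in (0 : ℝ)..t, 4 * weightedMomentum (u s) := by
  obtain ⟨m, hm⟩ := hu.exists_norm_le ht
  obtain ⟨C, hC⟩ := hu.exists_variance_le hT hxu₀ ht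
  have he0 : ∀ n : ℕ, (0 : ℝ) < 1 / ((n : ℝ) + 1) := fun n => by positivity
  have he := tendsto_one_div_add_atTop_nhds_zero_nat (𝕜 := ℝ)
  have hsub := Icc_subset_timeInterval ht
  have hIoc : ∀ {s}, s ∈ Set.uIoc 0 t → s ∈ Set.Icc 0 t := fun {s} hs => by
    rw [Set.uIoc_of_le ht.1] at hs
    exact ⟨hs.1.le, hs.2⟩
  have h1 := (tendsto_integral_cutoff (hC t ⟨ht.1, le_rfl⟩).1 he0 he).sub
    (tendsto_integral_cutoff (hC 0 ⟨le_rfl, ht.1⟩).1 he0 he)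
  have h2 : Tendsto (fun n : ℕ => ∫ s in (0 : ℝ)..t,
      2 * (∫ x, ((deriv (cutoff (1 / ((n : ℝ) + 1))) x : ℝ) : ℂ) * (starRingEnd ℂ) (u s x)
        * (u s).dx x).im) atTop (𝓝 (∫ s in (0 : ℝ)..t, 4 * weightedMomentum (u s))) := by
    refine intervalIntegral.tendsto_integral_filter_of_dominated_convergence
      (fun _ => 2 * C + 2 * m ^ 2) (Eventually.of_forall fun n => ?_)
      (Eventually.of_forall fun n => Eventually.of_forall fun s hs => ?_)
      intervalIntegrable_const (Eventually.of_forall fun s hs => ?_)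
    · exact ((hu.hasDerivWithinAt_cutoff hT (he0 n)).2.mono
        fun s hs => hsub (hIoc hs)).aestronglyMeasurable measurableSet_uIoc
    · have a1 := abs_flux_le_of_memLp (he0 n) (hC s (hIoc hs)).1
      have a2 := (hC s (hIoc hs)).2
      have a3 : ‖u s‖ ^ 2 ≤ m ^ 2 := by
        have := hm s (hIoc hs)
        gcongr
      rw [Real.norm_eq_abs]
      linarith
    · exact tendsto_flux (hC s (hIoc hs)).1 he0 he
  have h3 := tendsto_nhds_unique h1 (h2.congr fun n =>
    integral_eq_sub_of_hasDerivWithinAt_timeInterval (hu.hasDerivWithinAt_cutoff hT (he0 n)).1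
      (hu.hasDerivWithinAt_cutoff hT (he0 n)).2 ht)
  linarith

/-- For fixed `c > 1` the difference quotient of the dilation integral is differentiable in time.
Integrating first and letting `c ↓ 1` afterwards avoids differentiating the momentum directly. -/
theorem weightedMomentum_eq_integral (hu : IsSolution γ p u₀ T u) (hp : 1 < p) (hT : 0 < T)
    (hxu₀ : MemLp (fun x : ℝ => (x : ℂ) * u₀ x) 2 volume) {t : ℝ} (ht : t ∈ timeInterval T) :
    weightedMomentum (u t) = weightedMomentum (u 0) + ∫ s in (0 : ℝ)..t, 2 * Q γ p (u s) := by
  obtain ⟨m, hm⟩ := hu.exists_norm_le ht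
  obtain ⟨C, hC⟩ := hu.exists_variance_le hT hxu₀ ht
  have hr : ∀ s ∈ Set.Icc 0 t, l2 (fun x : ℝ => (x : ℂ) * u s x) ≤ √C := fun s hs => by
    refine Real.le_sqrt_of_sq_le ?_
    rw [l2_sq (hC s hs).1]
    exact (hC s hs).2
  have hsub := Icc_subset_timeInterval ht
  have hIoc : ∀ {s}, s ∈ Set.uIoc 0 t → s ∈ Set.Icc 0 t := fun {s} hs => by
    rw [Set.uIoc_of_le ht.1] at hs
    exact ⟨hs.1.le, hs.2⟩
  have hcont : ∀ {c : ℝ}, 0 < c → ContinuousOn (fun s => (c - 1)⁻¹ *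
      (energyCorrelation γ p (u s) c - c⁻¹ * energyCorrelation γ p (u s) c⁻¹))
      (timeInterval T) := fun {c} hc =>
    ((hu.continuousOn_energyCorrelation hT hc).sub
      ((hu.continuousOn_energyCorrelation hT (inv_pos.2 hc)).const_mul _)).const_mul _
  have h1 := (tendsto_im_dilation_div (u t) (hC t ⟨ht.1, le_rfl⟩).1).sub
    (tendsto_im_dilation_div (u 0) (hC 0 ⟨le_rfl, ht.1⟩).1)
  have h2 : Tendsto (fun c : ℝ => ∫ s in (0 : ℝ)..t, (c - 1)⁻¹ *
      (energyCorrelation γ p (u s) c - c⁻¹ * energyCorrelation γ p (u s) c⁻¹)) (𝓝[>] 1)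
      (𝓝 (∫ s in (0 : ℝ)..t, 2 * Q γ p (u s))) := by
    refine intervalIntegral.tendsto_integral_filter_of_dominated_convergence
      (fun _ => 2 * m ^ 2 + |γ| * (2 * m) ^ 2
        + (2 * (2 * m * ((2 * m) ^ (p - 1) * √C)) + (2 * m) ^ (p - 1) * m ^ 2)) ?_ ?_
      intervalIntegrable_const (Eventually.of_forall fun s hs => ?_)
    · filter_upwards [self_mem_nhdsWithin] with c hc
      exact ((hcont (lt_trans one_pos hc)).mono
        fun s hs => hsub (hIoc hs)).aestronglyMeasurable measurableSet_uIoc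
    · filter_upwards [Ioo_mem_nhdsGT (one_lt_two (α := ℝ))] with c hc
      refine Eventually.of_forall fun s hs => ?_
      exact abs_energyCorrelation_sub_div_le γ hp (u s) (hC s (hIoc hs)).1 (hm s (hIoc hs))
        (hr s (hIoc hs)) hc.1 hc.2.le
    · exact tendsto_energyCorrelation_sub_div γ hp (u s) (hC s (hIoc hs)).1
  have h3 := tendsto_nhds_unique h1 (h2.congr' ?_)
  · linarith
  · filter_upwards [self_mem_nhdsWithin] with c hc
    have hc0 : 0 < c := lt_trans one_pos hc
    exact integral_eq_sub_of_hasDerivWithinAt_timeInterval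
      (fun s hs => (hu.hasDerivWithinAt_im_dilation hc0 hs).const_mul _) (hcont hc0) ht

theorem hasDerivWithinAt_weightedMomentum (hu : IsSolution γ p u₀ T u) (hp : 1 < p) (hT : 0 < T)
    (hxu₀ : MemLp (fun x : ℝ => (x : ℂ) * u₀ x) 2 volume) {t : ℝ} (ht : t ∈ timeInterval T) :
    HasDerivWithinAt (fun s => weightedMomentum (u s)) (2 * Q γ p (u t)) (timeInterval T) t :=
  hasDerivWithinAt_of_eq_integral (F := fun s => weightedMomentum (u s))
    (G := fun s => 2 * Q γ p (u s)) ((hu.continuousOn_Q hT hp).const_mul 2)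
    (fun _ hs => hu.weightedMomentum_eq_integral hp hT hxu₀ hs) ht

theorem hasDerivWithinAt_variance (hu : IsSolution γ p u₀ T u) (hp : 1 < p) (hT : 0 < T)
    (hxu₀ : MemLp (fun x : ℝ => (x : ℂ) * u₀ x) 2 volume) {t : ℝ} (ht : t ∈ timeInterval T) :
    HasDerivWithinAt (fun s => variance (u s)) (4 * weightedMomentum (u t)) (timeInterval T) t :=
  hasDerivWithinAt_of_eq_integral (F := fun s => variance (u s))
    (G := fun s => 4 * weightedMomentum (u s))
    (ContinuousOn.const_mul (fun _ hs =>
      (hu.hasDerivWithinAt_weightedMomentum hp hT hxu₀ hs).continuousWithinAt) 4)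
    (fun _ hs => hu.variance_eq_integral hT hxu₀ hs) ht

end IsSolution

end DeltaNLS

end

theorem proposition3 (γ p : ℝ) (hp : 1 < p) (u₀ : DeltaNLS.H1)
    (hxu₀ : MemLp (fun x : ℝ => (x : ℂ) * u₀ x) 2 volume)
    (T : EReal) (hT : 0 < T) (u : ℝ → DeltaNLS.H1) (hu : DeltaNLS.IsSolution γ p u₀ T u) :
    (∀ t ∈ DeltaNLS.timeInterval T,
      MemLp (fun x : ℝ => (x : ℂ) * u t x) 2 volume ∧
      Integrable (fun x : ℝ => (starRingEnd ℂ) (u t x) * (x : ℂ) * (u t).dx x) volume) ∧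
    ContDiffOn ℝ 2 (fun t => DeltaNLS.variance (u t)) (DeltaNLS.timeInterval T) ∧
    ∀ t ∈ DeltaNLS.timeInterval T,
      HasDerivWithinAt (fun s => DeltaNLS.variance (u s))
        (4 * (∫ x : ℝ, (starRingEnd ℂ) (u t x) * (x : ℂ) * (u t).dx x).im)
        (DeltaNLS.timeInterval T) t ∧
      HasDerivWithinAt
        (derivWithin (fun s => DeltaNLS.variance (u s)) (DeltaNLS.timeInterval T))
        (8 * DeltaNLS.Q γ p (u t)) (DeltaNLS.timeInterval T) t := by
  have hI := DeltaNLS.uniqueDiffOn_timeInterval hT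
  have h1 : ∀ t ∈ DeltaNLS.timeInterval T, HasDerivWithinAt (fun s => DeltaNLS.variance (u s))
      (4 * DeltaNLS.weightedMomentum (u t)) (DeltaNLS.timeInterval T) t := fun t ht =>
    hu.hasDerivWithinAt_variance hp hT hxu₀ ht
  have h2 : ∀ t ∈ DeltaNLS.timeInterval T,
      derivWithin (fun s => DeltaNLS.variance (u s)) (DeltaNLS.timeInterval T) t
        = 4 * DeltaNLS.weightedMomentum (u t) := fun t ht => (h1 t ht).derivWithin (hI t ht)
  have h3 : ∀ t ∈ DeltaNLS.timeInterval T, HasDerivWithinAt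
      (derivWithin (fun s => DeltaNLS.variance (u s)) (DeltaNLS.timeInterval T))
      (8 * DeltaNLS.Q γ p (u t)) (DeltaNLS.timeInterval T) t := by
    intro t ht
    have h := (hu.hasDerivWithinAt_weightedMomentum hp hT hxu₀ ht).const_mul 4
    rw [← mul_assoc] at h
    norm_num at h
    exact h.congr_of_mem h2 ht
  refine ⟨fun t ht => ?_, ?_, fun t ht => ⟨h1 t ht, h3 t ht⟩⟩
  · have hm := hu.memLp_weighted hT hxu₀ ht
    exact ⟨hm, DeltaNLS.integrable_weightedMomentum (u t) hm⟩
  · rw [show (2 : WithTop ℕ∞) = 1 + 1 by norm_num, contDiffOn_succ_iff_derivWithin hI]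
    refine ⟨fun t ht => (h1 t ht).differentiableWithinAt, by simp, ?_⟩
    rw [contDiffOn_one_iff_derivWithin hI]
    refine ⟨fun t ht => (h3 t ht).differentiableWithinAt, ?_⟩
    exact ((hu.continuousOn_Q hT hp).const_mul 8).congr fun t ht =>
      (h3 t ht).derivWithin (hI t ht)
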